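/- Let $P$ be a smooth (Hausdorff, second countable, $d$-dimensional) Poisson manifold with bracket $\{\cdot,\cdot\}$ on $C^\infty(P)$, and let $g$ be a Riemannian metric on $P$. Let $B(z)(\mathbf dF(z),\mathbf dG(z))=\{F,G\}(z)$ be the Poisson tensor, $B^\sharp:T^*P\to TP$ the bundle map with $\alpha\cdot B^\sharp(z)(\beta)=B(z)(\alpha,\beta)$, $X_h=B^\sharp(\mathbf dh)$ the Hamiltonian vector field of a $C^1$ function $h$, and $J(z)v=B^\sharp(z)(g^\flat(z)v)$ the compatible structure. Assume that there are $C>0$ and a function $\gamma:P\to(0,C^2]$ with $$g(z)(J(z)v,J(z)v)\le\gamma(z)\,g(z)(v,v)\qquad\text{for all } z\in P,\ v\in T_zP.$$ For a function $f$ on a manifold $M$ let $Df:TM\to\mathbb R$ be its differential and, inductively, $D^kf:T^kM\to\mathbb R$ the differential of $D^{k-1}f:T^{k-1}M\to\mathbb R$. Given Riemannian metrics $g_{k}$ on $T^{k}M$ (with $T^0M=M$), let $$\|D^kf\|_\infty=\sup_{y\in T^{k-1}M}\ \sup_{0\ne v\in T_y(T^{k-1}M)}\frac{|D^kf(y)\cdot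 v|}{\|v\|_{g_{k-1}}},\qquad \|f\|_{C_b^s}=\|f\|_\infty+\sum_{k=1}^s\|D^kf\|_\infty,$$ and let $C^s_b(M)$ be the set of $C^s$ functions with $\|f\|_{C_b^s}<\infty$. On $M=P\times P$ use $g_0=g\oplus g$ and arbitrary Riemannian metrics $g_1$ on $T(P\times P)$ and $g_2$ on $TT(P\times P)$ such that $g_1$ is adapted to $g$ in the following sense: for all $x\in P$ and $u\in T_xP$ with $g(x)(u,u)=1$, the map $P\to T(P\times P)$, $y\mapsto (u,0)\in T_{(x,y)}(P\times P)$, does not increase the lengths of tangent vectors (this holds, for instance, for the Sasaki metric of $g\oplus g$). Let $K\in C_b^3(P\times P)$ be a Mercer kernel (symmetric and positive semidefinite), $\mathcal H_K$ its reproducing kernel Hilbert space, $K_y=K(y,\cdot)$, and let $\kappa\ge 0$ be given by $\kappa^2=2\|K\|_{C_b^2}$. Let $N\ge1$ and let $\mathbf Z^{(1)},\dots,\mathbf Z^{(N)}$ be i.i.d. random variables with values in $P$ and law $\mu_{\mathbf Z}$. Then $X_h$ is square integrable with respect to $g$ and $\mu_{\mathbf Z}$ for every $h\in\mathcal H_K$,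 and the formulas $$(Qh)(y)=\int_P g(z)\big(X_{K_y}(z),X_h(z)\big)\,\mathrm d\mu_{\mathbf Z}(z),\qquad (Q_Nh)(y)=\frac1N\sum_{n=1}^N g(\mathbf Z^{(n)})\big(X_h(\mathbf Z^{(n)}),X_{K_y}(\mathbf Z^{(n)})\big)$$ define bounded linear operators $Q,Q_N:\mathcal H_K\to\mathcal H_K$ with $Q=A^*A$ and $Q_N=A_N^*A_N$, where $Ah=X_h$ in the space of $L^2(\mu_{\mathbf Z})$ vector fields with inner product $\int_P g(z)(Y(z),Y'(z))\,\mathrm d\mu_{\mathbf Z}(z)$, and $A_Nh=N^{-1/2}\big(X_h(\mathbf Z^{(n)})\big)_{n=1}^N$ in $\prod_n T_{\mathbf Z^{(n)}}P$ with inner product $g_N(u,v)=\sum_n g(\mathbf Z^{(n)})(u_n,v_n)$. Moreover, for every $h\in\mathcal H_K$ and every $0<\delta<1$, with probability at least $1-\delta$, $$\|Q_Nh-Qh\|_{\mathcal H_K}\le\left(\sqrt{\frac{8\log(2/\delta)}{N}}+1\right)\sqrt{\frac{\log(2/\delta)}{N}}\;C^2\kappa^2\,\|h\|_{\mathcal H_K}.$$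 -/

import Mathlib

open scoped Manifold ContDiff ENNReal Bundle
open MeasureTheory

noncomputable section

namespace PoissonRegression

section Manifold

variable {E : Type*} [NormedAddCommGroup E] [NormedSpace ℝ E] {H : Type*} [TopologicalSpace H]
  (I : ModelWithCorners ℝ E H) {M : Type*} [TopologicalSpace M] [ChartedSpace H M]

/-- The differential `df(x)`, a covector at `x`. -/
def differential (f : M → ℝ) (x : M) : TangentSpace I x →L[ℝ] ℝ :=
  mfderiv I 𝓘(ℝ, ℝ) f x

/-- The differential of `f` as a function `Df : TM → ℝ`. Iterating gives `D²f : TTM → ℝ`, etc. -/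
def diffTB (f : M → ℝ) : TangentBundle I M → ℝ :=
  fun p => differential I f p.1 p.2

/-- `sup_x sup_{v ≠ 0} |df(x) v| / √(q x v)`, where `q x` is the squared norm on `T_x M`. -/
def supDiff (q : ∀ x : M, TangentSpace I x → ℝ) (f : M → ℝ) : ℝ≥0∞ :=
  ⨆ (x : M) (v : TangentSpace I x) (_ : v ≠ 0),
    ENNReal.ofReal (|differential I f x v| / √(q x v))

/-- A smooth Riemannian metric on `M`. -/
abbrev RMetric (M : Type*) [TopologicalSpace M] [ChartedSpace H M] [IsManifold I 1 M] :=
  Bundle.ContMDiffRiemannianMetric I ∞ E (TangentSpace I : M → Type _)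

/-- `‖f‖_{C_b²} = ‖f‖_∞ + ‖Df‖_∞ + ‖D²f‖_∞`, with values in `[0, ∞]`; `q₀` and `q₁` are the squared
norms on the fibres of `TM` and of `TTM`. -/
def cbNorm2 [IsManifold I 1 M] (q₀ : ∀ x : M, TangentSpace I x → ℝ)
    (q₁ : ∀ y : TangentBundle I M, TangentSpace I.tangent y → ℝ) (f : M → ℝ) : ℝ≥0∞ :=
  (⨆ x, ENNReal.ofReal |f x|) + supDiff I q₀ f + supDiff I.tangent q₁ (diffTB I f)

/-- `‖f‖_{C_b³} = ‖f‖_{C_b²} + ‖D³f‖_∞`, with values in `[0, ∞]`. -/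
def cbNorm3 [IsManifold I 2 M] [IsManifold I 1 M] (q₀ : ∀ x : M, TangentSpace I x → ℝ)
    (q₁ : ∀ y : TangentBundle I M, TangentSpace I.tangent y → ℝ)
    (q₂ : ∀ y : TangentBundle I.tangent (TangentBundle I M), TangentSpace I.tangent.tangent y → ℝ)
    (f : M → ℝ) : ℝ≥0∞ :=
  cbNorm2 I q₀ q₁ f + supDiff I.tangent.tangent q₂ (diffTB I.tangent (diffTB I f))

end Manifold

section Poisson

variable (d : ℕ) (P : Type*) [TopologicalSpace P] [ChartedSpace (EuclideanSpace ℝ (Fin d)) P]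

/-- A Poisson bracket on `C^∞(P)`: a Lie bracket that is a derivation in the first factor (hence, by
antisymmetry, in each factor). -/
structure PoissonBracket where
  bracket : C^∞⟮𝓡 d, P; 𝓘(ℝ, ℝ), ℝ⟯ →ₗ[ℝ] C^∞⟮𝓡 d, P; 𝓘(ℝ, ℝ), ℝ⟯ →ₗ[ℝ] C^∞⟮𝓡 d, P; 𝓘(ℝ, ℝ), ℝ⟯
  bracket_self : ∀ F, bracket F F = 0
  jacobi : ∀ F G H,
    bracket F (bracket G H) + bracket G (bracket H F) + bracket H (bracket F G) = 0
  leibniz : ∀ F G H, bracket (F * G) H = bracket F H * G + F * bracket G H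

variable {d P}

/-- Every covector at `z` is the differential at `z` of a smooth function. -/
theorem exists_differential_eq [T2Space P] [IsManifold (𝓡 d) ∞ P] (z : P)
    (α : TangentSpace (𝓡 d) z →L[ℝ] ℝ) :
    ∃ F : C^∞⟮𝓡 d, P; 𝓘(ℝ, ℝ), ℝ⟯, differential (𝓡 d) F z = α := by
  obtain ⟨b⟩ : Nonempty (SmoothBumpFunction (𝓡 d) z) := inferInstance
  let α' : EuclideanSpace ℝ (Fin d) →L[ℝ] ℝ := α
  have h1 : ContMDiffOn (𝓡 d) 𝓘(ℝ, ℝ) ∞ (fun x => α' (extChartAt (𝓡 d) z x))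
      (chartAt (EuclideanSpace ℝ (Fin d)) z).source :=
    α'.contMDiff.comp_contMDiffOn contMDiffOn_extChartAt
  refine ⟨⟨fun x => b x • α' (extChartAt (𝓡 d) z x), b.contMDiff_smul h1⟩, ?_⟩
  have h2 : (fun x => b x • α' (extChartAt (𝓡 d) z x)) =ᶠ[nhds z]
      (α' ∘ extChartAt (𝓡 d) z) := by
    filter_upwards [b.eventuallyEq_one] with x hx
    simp [hx]
  have h3 : HasMFDerivAt (𝓡 d) 𝓘(ℝ, ℝ) (α' ∘ extChartAt (𝓡 d) z) z
      (α'.comp (mfderiv (𝓡 d) 𝓘(ℝ, EuclideanSpace ℝ (Fin d)) (extChartAt (𝓡 d) z) z)) :=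
    (α'.hasMFDerivAt).comp z
      (mdifferentiableAt_extChartAt (mem_chart_source _ z)).hasMFDerivAt
  change mfderiv (𝓡 d) 𝓘(ℝ, ℝ) (fun x => b x • α' (extChartAt (𝓡 d) z x)) z = α
  rw [h2.mfderiv_eq, h3.mfderiv, mfderiv_extChartAt_self]
  rfl

namespace PoissonBracket

variable [T2Space P] [IsManifold (𝓡 d) ∞ P] (B : PoissonBracket d P)

/-- The Poisson tensor `B(z)(α, β) = {F, G}(z)` where `dF(z) = α` and `dG(z) = β`; by the derivation
property the value does not depend on which such `F` and `G` are used. -/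
def tensor (z : P) (α β : TangentSpace (𝓡 d) z →L[ℝ] ℝ) : ℝ :=
  B.bracket (exists_differential_eq z α).choose (exists_differential_eq z β).choose z

/-- The `i`-th vector of the standard basis of `T_z P`. -/
def stdVec (z : P) (i : Fin d) : TangentSpace (𝓡 d) z :=
  (EuclideanSpace.single i (1 : ℝ) : EuclideanSpace ℝ (Fin d))

/-- The `i`-th covector of the dual of the standard basis of `T_z P`. -/
def stdCovec (z : P) (i : Fin d) : TangentSpace (𝓡 d) z →L[ℝ] ℝ :=
  (EuclideanSpace.proj i : EuclideanSpace ℝ (Fin d) →L[ℝ] ℝ)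

/-- The bundle map `B♯ : T*P → TP`, that is, the vector `B♯(z)(β)` with
`α (B♯(z)(β)) = B(z)(α, β)` for all covectors `α`, written out in a basis. -/
def sharp (z : P) (β : TangentSpace (𝓡 d) z →L[ℝ] ℝ) : TangentSpace (𝓡 d) z :=
  ∑ i, B.tensor z (stdCovec z i) β • stdVec z i

/-- The Hamiltonian vector field `X_h = B♯(dh)` (for `h` of class `C¹`). -/
def hamVF (h : P → ℝ) (z : P) : TangentSpace (𝓡 d) z :=
  B.sharp z (differential (𝓡 d) h z)

/-- The compatible structure `J(z) v = B♯(z)(g♭(z) v)`. -/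
def compatible (g : RMetric (𝓡 d) P) (z : P) (v : TangentSpace (𝓡 d) z) : TangentSpace (𝓡 d) z :=
  B.sharp z (g.inner z v)

/-- `g(z)(J v, J v) ≤ γ(z) g(z)(v, v)` for a positive function `γ` bounded above by `C²`. -/
def CompatibleBound (g : RMetric (𝓡 d) P) (C : ℝ) : Prop :=
  ∃ γ : P → ℝ, (∀ z, 0 < γ z ∧ γ z ≤ C ^ 2) ∧
    ∀ (z : P) (v : TangentSpace (𝓡 d) z),
      g.inner z (B.compatible g z v) (B.compatible g z v) ≤ γ z * g.inner z v v

end PoissonBracket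

end Poisson

section Kernel

/-- A Mercer kernel: symmetric and positive semidefinite. -/
def IsMercer {X : Type*} (K : X × X → ℝ) : Prop :=
  (∀ x y, K (x, y) = K (y, x)) ∧
    ∀ (n : ℕ) (x : Fin n → X) (c : Fin n → ℝ), 0 ≤ ∑ i, ∑ j, c i * c j * K (x i, x j)

variable {d : ℕ} {P : Type*} [TopologicalSpace P] [ChartedSpace (EuclideanSpace ℝ (Fin d)) P]
  [IsManifold (𝓡 d) ∞ P]

variable (d) in
/-- The model with corners of `P × P`. -/
abbrev 𝓡2 := (𝓡 d).prod (𝓡 d)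

/-- The squared norm of the product metric `g ⊕ g` on `P × P`. -/
def prodSq (g : RMetric (𝓡 d) P) (p : P × P) (v : TangentSpace (𝓡2 d) p) : ℝ :=
  g.inner p.1 (v.1 : EuclideanSpace ℝ (Fin d)) (v.1 : EuclideanSpace ℝ (Fin d)) +
    g.inner p.2 (v.2 : EuclideanSpace ℝ (Fin d)) (v.2 : EuclideanSpace ℝ (Fin d))

/-- For fixed `x` and `u ∈ T_x P`, the map `P → T(P × P)` sending `y` to the vector `(u, 0)` at the
point `(x, y)`. -/
def sliceLift (x : P) (u : TangentSpace (𝓡 d) x) (y : P) : TangentBundle (𝓡2 d) (P × P) :=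
  ⟨(x, y), ((u : EuclideanSpace ℝ (Fin d)), (0 : EuclideanSpace ℝ (Fin d)))⟩

/-- For unit vectors `u ∈ T_x P`, the map `sliceLift x u : P → T(P × P)` does not increase lengths,
where `T(P × P)` carries the metric `g₁`. This holds for the Sasaki metric. -/
def IsAdapted (g : RMetric (𝓡 d) P) (g₁ : RMetric (𝓡2 d).tangent (TangentBundle (𝓡2 d) (P × P))) :
    Prop :=
  ∀ (x : P) (u : TangentSpace (𝓡 d) x) (y : P) (v : TangentSpace (𝓡 d) y), g.inner x u u = 1 →
    g₁.inner (sliceLift x u y) (mfderiv (𝓡 d) (𝓡2 d).tangent (sliceLift x u) y v)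
      (mfderiv (𝓡 d) (𝓡2 d).tangent (sliceLift x u) y v) ≤ g.inner y v v

/-- `K ∈ C_b³(P × P)`, for the metrics `g ⊕ g`, `g₁`, `g₂` on `P × P`, `T(P × P)`, `TT(P × P)`. -/
def MemCb3 (g : RMetric (𝓡 d) P) (g₁ : RMetric (𝓡2 d).tangent (TangentBundle (𝓡2 d) (P × P)))
    (g₂ : RMetric (𝓡2 d).tangent.tangent
      (TangentBundle (𝓡2 d).tangent (TangentBundle (𝓡2 d) (P × P))))
    (K : P × P → ℝ) : Prop :=
  ContMDiff (𝓡2 d) 𝓘(ℝ, ℝ) 3 K ∧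
    cbNorm3 (𝓡2 d) (prodSq g) (fun y v => g₁.inner y v v) (fun y v => g₂.inner y v v) K ≠ ⊤

/-- The constant `κ` with `κ² = 2 ‖K‖_{C_b²}`. -/
def kappa (g : RMetric (𝓡 d) P) (g₁ : RMetric (𝓡2 d).tangent (TangentBundle (𝓡2 d) (P × P)))
    (K : P × P → ℝ) : ℝ :=
  √(2 * (cbNorm2 (𝓡2 d) (prodSq g) (fun y v => g₁.inner y v v) K).toReal)

end Kernel

section Operators

variable {d : ℕ} {P : Type*} [TopologicalSpace P] [ChartedSpace (EuclideanSpace ℝ (Fin d)) P]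
  [IsManifold (𝓡 d) ∞ P] [T2Space P] (g : RMetric (𝓡 d) P) (B : PoissonBracket d P)
  (K : P × P → ℝ)
  {HK : Type*} [NormedAddCommGroup HK] [InnerProductSpace ℝ HK] [RKHS ℝ HK P ℝ]

/-- `Q = A* A` where `A h = X_h`, as an operator from `HK` to the `L²(μ)` vector fields, and
`Q h = ∫ g(z)(X_{K_·}(z), X_h(z)) dμ(z)`. -/
structure IsPopulationOperator [MeasurableSpace P] (μ : Measure P) (Q : HK →L[ℝ] HK) : Prop where
  integrable : ∀ f h : HK, Integrable (fun z => g.inner z (B.hamVF f z) (B.hamVF h z)) μ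
  inner_eq : ∀ f h : HK, inner ℝ f (Q h) = ∫ z, g.inner z (B.hamVF f z) (B.hamVF h z) ∂μ
  apply_eq : ∀ (h : HK) (y : P),
    Q h y = ∫ z, g.inner z (B.hamVF (fun x => K (y, x)) z) (B.hamVF h z) ∂μ

/-- `A_N h = N^{-1/2} (X_h(z_1), …, X_h(z_N))`. -/
def empA {N : ℕ} (z : Fin N → P) (h : HK) (n : Fin N) : TangentSpace (𝓡 d) (z n) :=
  (1 / √(N : ℝ)) • B.hamVF h (z n)

/-- `Q_N = A_N* A_N`, for the inner product `g_N(u, v) = ∑ₙ g(z_n)(u_n, v_n)` on `∏ₙ T_{z_n} P`, and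
`Q_N h = (1/N) g_N(X_h(z_N), X_{K_·}(z_N))`. -/
structure IsEmpiricalOperator {N : ℕ} (z : Fin N → P) (QN : HK →L[ℝ] HK) : Prop where
  inner_eq : ∀ f h : HK, inner ℝ f (QN h) = ∑ n, g.inner (z n) (empA B z f n) (empA B z h n)
  apply_eq : ∀ (h : HK) (y : P),
    QN h y = (1 / (N : ℝ)) *
      ∑ n, g.inner (z n) (B.hamVF h (z n)) (B.hamVF (fun x => K (y, x)) (z n))

end Operators

end PoissonRegression

end

open PoissonRegression

/-! For each point `z` let `T z` be the operator `A_z* A_z` of the evaluation `h ↦ X_h(z)`. Then `Q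
h` is the expectation of `T z h` and `Q_N h` is its empirical mean, so the estimate is a law of
large numbers with explicit deviation for bounded random vectors in a separable Hilbert space.

The bound on these vectors comes from the kernel. Let `S = ‖D²K‖_∞`. Adaptedness of `g₁` turns `S`
into a bound on the mixed derivative `∂₁∂₂K` (`abs_differential_partialFst_le`). Since `‖K_x -
K_y‖²` is a second difference of `K`, the map `x ↦ K_x` is `√S`-Lipschitz along curves
(`norm_kerFun_sub_le`), and pairing with `h` gives `|dh(z) u| ≤ √S ‖h‖ |u|` (`abs_differential_le`).
The same bound makes derivatives converge uniformly in charts, so every `h` is differentiable. Since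
`X_h = J ∇h`, it follows that `|X_h(z)|² ≤ C² S ‖h‖²`, hence `‖T z h‖ ≤ R` with `R = C² S ‖h‖`,
where `2S ≤ κ²`.

For the deviation, a 1-Lipschitz function of the sum is sub-Gaussian with variance proxy `N R²`
(`integral_exp_lipschitz_sum_le`), and the mean norm of the centred sum is at most `√N R` because
variances add. Together they give the radius `2 R √(log (2 / δ) / N)`, which is at most `C² κ² ‖h‖
√(log (2 / δ) / N)`. The factor `√(8 log (2 / δ) / N) + 1` in the claim is at least `1`, so the
claim is weaker than what is obtained. -/

noncomputable section

namespace PoissonRegression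

/-! ### Sub-Gaussian bounds for Lipschitz functions of i.i.d. sums. -/

section Concentration

theorem norm_sum_comp_le {X V : Type*} [NormedAddCommGroup V] {ξ : X → V} {R : ℝ}
    (hR : ∀ x, ‖ξ x‖ ≤ R) {n : ℕ} (z : Fin n → X) :
    ‖∑ i, ξ (z i)‖ ≤ n * R := by
  simpa using norm_sum_le_of_le Finset.univ fun i _ => hR (z i)

theorem _root_.LipschitzWith.abs_le_of_norm_le {V : Type*} [NormedAddCommGroup V] {F : V → ℝ}
    (hF : LipschitzWith 1 F) {v : V} {r : ℝ}
    (h : ‖v‖ ≤ r) : |F v| ≤ |F 0| + r := by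
  have h1 := hF.dist_le_mul v 0
  rw [Real.dist_eq, dist_zero_right] at h1
  have h2 := abs_sub_abs_le_abs_sub (F v) (F 0)
  simp only [NNReal.coe_one, one_mul] at h1
  linarith

open ProbabilityTheory

variable {X : Type*} [MeasurableSpace X] (μ : Measure X) [IsProbabilityMeasure μ]

theorem integral_pi_fin_succ {n : ℕ} (Φ : (Fin (n + 1) → X) → ℝ)
    (hΦ : Integrable Φ (Measure.pi fun _ => μ)) :
    ∫ z, Φ z ∂(Measure.pi fun _ => μ) =
      ∫ w, ∫ x, Φ (Fin.cons x w) ∂μ ∂(Measure.pi fun _ : Fin n => μ) := by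
  have e := (measurePreserving_piFinSuccAbove (fun _ : Fin (n + 1) => μ) 0).symm
  rw [← e.integral_comp' (g := Φ), integral_prod_symm]
  · simp only [MeasurableEquiv.piFinSuccAbove_symm_apply, Fin.insertNthEquiv_zero]
    rfl
  · exact e.integrable_comp_of_integrable hΦ

variable {V : Type*} [NormedAddCommGroup V] {ξ : X → V} {R : ℝ}

theorem stronglyMeasurable_sum_comp (hξ : StronglyMeasurable ξ) (n : ℕ) :
    StronglyMeasurable fun z : Fin n → X => ∑ i, ξ (z i) :=
  Finset.stronglyMeasurable_fun_sum _ fun i _ => hξ.comp_measurable (measurable_pi_apply i)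

/-- A continuous function of a bounded sum is integrable as soon as it is bounded on balls. -/
theorem integrable_comp_sum (hξ : StronglyMeasurable ξ) (n : ℕ) {G : V → ℝ} (hG : Continuous G)
    {c : ℝ} (hc : ∀ z : Fin n → X, |G (∑ i, ξ (z i))| ≤ c) :
    Integrable (fun z : Fin n → X => G (∑ i, ξ (z i))) (Measure.pi fun _ => μ) :=
  Integrable.of_bound
    (hG.comp_stronglyMeasurable (stronglyMeasurable_sum_comp hξ n)).aestronglyMeasurable
    c (Filter.Eventually.of_forall hc)

theorem integrable_lipschitz_add (hξ : StronglyMeasurable ξ) (hR : ∀ x, ‖ξ x‖ ≤ R) {F : V → ℝ}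
    (hF : LipschitzWith 1 F) (s : V) : Integrable (fun x => F (ξ x + s)) μ := by
  refine Integrable.of_bound (hF.continuous.comp_stronglyMeasurable
    (hξ.add stronglyMeasurable_const)).aestronglyMeasurable (|F 0| + (R + ‖s‖))
    (Filter.Eventually.of_forall fun x => ?_)
  exact hF.abs_le_of_norm_le ((norm_add_le _ _).trans (by linarith [hR x]))

/-- Averaging translates preserves the Lipschitz constant, so integrating out one summand leaves a
function to which the induction hypothesis applies. -/
theorem lipschitzWith_integral_add (hξ : StronglyMeasurable ξ) (hR : ∀ x, ‖ξ x‖ ≤ R) {F : V → ℝ}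
    (hF : LipschitzWith 1 F) : LipschitzWith 1 fun s => ∫ x, F (ξ x + s) ∂μ := by
  refine LipschitzWith.of_dist_le_mul fun s t => ?_
  rw [dist_eq_norm, ← integral_sub (integrable_lipschitz_add μ hξ hR hF s)
    (integrable_lipschitz_add μ hξ hR hF t)]
  refine (norm_integral_le_of_norm_le_const (C := dist s t)
    (Filter.Eventually.of_forall fun x => ?_)).trans (by simp)
  simpa [dist_eq_norm] using hF.dist_le_mul (ξ x + s) (ξ x + t)

/-- Hoeffding's lemma: with `s` frozen, the Lipschitz property confines `F (ξ x + s)` to an interval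
around `F s` of half-length `R`. -/
theorem integral_exp_lipschitz_add_le (hξ : StronglyMeasurable ξ) (hR : ∀ x, ‖ξ x‖ ≤ R)
    {F : V → ℝ} (hF : LipschitzWith 1 F) (t : ℝ) (s : V) :
    ∫ x, Real.exp (t * F (ξ x + s)) ∂μ ≤
      Real.exp (t * (∫ x, F (ξ x + s) ∂μ) + R ^ 2 * t ^ 2 / 2) := by
  have hm := (integrable_lipschitz_add μ hξ hR hF s).aemeasurable
  have hb : ∀ᵐ x ∂μ, F (ξ x + s) ∈ Set.Icc (F s - R) (F s + R) := by
    refine Filter.Eventually.of_forall fun x => ?_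
    have h := hF.dist_le_mul (ξ x + s) s
    rw [Real.dist_eq, dist_eq_norm, add_sub_cancel_right, NNReal.coe_one, one_mul] at h
    have := abs_le.1 (h.trans (hR x))
    constructor <;> linarith
  have h := (hasSubgaussianMGF_of_mem_Icc hm hb).mgf_le t
  have h3 : ((((‖F s + R - (F s - R)‖₊ / 2) ^ 2 : NNReal)) : ℝ) = R ^ 2 := by
    push_cast
    rw [Real.norm_eq_abs, div_pow, sq_abs]
    ring
  rw [h3, mgf] at h
  have h4 : ∀ x, Real.exp (t * (F (ξ x + s) - ∫ x, F (ξ x + s) ∂μ)) =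
      Real.exp (t * F (ξ x + s)) * Real.exp (-(t * ∫ x, F (ξ x + s) ∂μ)) := fun x => by
    rw [← Real.exp_add]
    ring_nf
  simp only [h4] at h
  rw [integral_mul_const, Real.exp_neg, ← div_eq_mul_inv, div_le_iff₀ (Real.exp_pos _),
    ← Real.exp_add] at h
  rwa [add_comm]

/-- A Lipschitz function of a sum of independent bounded random vectors is sub-Gaussian. -/
theorem integral_exp_lipschitz_sum_le (hξ : StronglyMeasurable ξ) (hR : ∀ x, ‖ξ x‖ ≤ R) (t : ℝ)
    (n : ℕ) : ∀ {F : V → ℝ}, LipschitzWith 1 F →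
    ∫ z : Fin n → X, Real.exp (t * F (∑ i, ξ (z i))) ∂(Measure.pi fun _ => μ) ≤
      Real.exp (t * (∫ z : Fin n → X, F (∑ i, ξ (z i)) ∂(Measure.pi fun _ => μ)) +
        n * (R ^ 2 * t ^ 2 / 2)) := by
  induction n with
  | zero => intro F _; simp
  | succ n ih =>
    intro F hF
    have hFb : ∀ (m : ℕ) (z : Fin m → X), |F (∑ i, ξ (z i))| ≤ |F 0| + m * R := fun m z =>
      hF.abs_le_of_norm_le (norm_sum_comp_le hR z)
    have i1 := integrable_comp_sum μ hξ (n + 1) hF.continuous (hFb _)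
    have hexp : ∀ {G : V → ℝ}, LipschitzWith 1 G → ∀ m : ℕ,
        Integrable (fun z : Fin m → X => Real.exp (t * G (∑ i, ξ (z i))))
          (Measure.pi fun _ => μ) := fun {G} hG m => by
      refine integrable_comp_sum μ hξ m (G := fun v => Real.exp (t * G v))
        (by have := hG.continuous; fun_prop) (c := Real.exp (|t| * (|G 0| + m * R))) fun z => ?_
      rw [abs_of_pos (Real.exp_pos _)]
      refine Real.exp_le_exp.2 ((le_abs_self _).trans ?_)
      rw [abs_mul]
      exact mul_le_mul_of_nonneg_left (hG.abs_le_of_norm_le (norm_sum_comp_le hR z))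
        (abs_nonneg t)
    -- The induction hypothesis is used for the average of `F` over the first variable; this is why
    -- the induction runs over all 1-Lipschitz functions.
    have hG := lipschitzWith_integral_add μ hξ hR hF
    have h1 := ih hG
    rw [integral_pi_fin_succ μ _ (hexp hF (n + 1)), integral_pi_fin_succ μ _ i1]
    simp only [Fin.sum_univ_succ, Fin.cons_zero, Fin.cons_succ]
    refine (integral_mono_of_nonneg (Filter.Eventually.of_forall fun w =>
      integral_nonneg fun x => (Real.exp_pos _).le) (((hexp hG n).mul_const
      (Real.exp (R ^ 2 * t ^ 2 / 2)))) (Filter.Eventually.of_forall fun w =>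
      (integral_exp_lipschitz_add_le μ hξ hR hF t _).trans_eq (Real.exp_add _ _))).trans ?_
    rw [integral_mul_const]
    refine (mul_le_mul_of_nonneg_right h1 (Real.exp_pos _).le).trans_eq ?_
    rw [← Real.exp_add]
    push_cast
    ring_nf

end Concentration

/-! ### Concentration of empirical means in Hilbert space. -/

section ConcentrationHilbert

/-- Weakly measurable functions into a separable Hilbert space are strongly measurable. -/
theorem stronglyMeasurable_of_forall_inner {X : Type*} [MeasurableSpace X] {V : Type*}
    [NormedAddCommGroup V] [InnerProductSpace ℝ V] {ξ : X → V} [TopologicalSpace.SeparableSpace V]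
    (h : ∀ v, Measurable fun x => inner ℝ v (ξ x)) : StronglyMeasurable ξ := by
  let e := TopologicalSpace.denseSeq V
  -- The projections of `ξ` onto an exhausting sequence of finite-dimensional subspaces are finite
  -- sums of measurable coefficients, and they converge pointwise to `ξ`.
  let U : ℕ → Submodule ℝ V := fun n => Submodule.span ℝ (e '' Set.Iio n)
  have hfin : ∀ n, FiniteDimensional ℝ (U n) := fun n =>
    FiniteDimensional.span_of_finite ℝ ((Set.finite_Iio n).image e)
  have hU : Monotone U := fun a b hab =>
    Submodule.span_mono (Set.image_mono (Set.Iio_subset_Iio hab))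
  have hden : (⊤ : Submodule ℝ V) ≤ (⨆ n, U n).topologicalClosure := fun v _ => by
    have : Set.range e ⊆ ((⨆ n, U n : Submodule ℝ V) : Set V) := by
      rintro _ ⟨n, rfl⟩
      exact (le_iSup U (n + 1)) (Submodule.subset_span ⟨n, Set.mem_Iio.2 n.lt_succ_self, rfl⟩)
    exact closure_mono this (TopologicalSpace.denseRange_denseSeq V v)
  refine stronglyMeasurable_of_tendsto (u := Filter.atTop)
    (f := fun n x => (U n).starProjection (ξ x)) (fun n => ?_)
    (tendsto_pi_nhds.2 fun x => Submodule.starProjection_tendsto_self U hU (ξ x) hden)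
  let b := stdOrthonormalBasis ℝ (U n)
  have hb : ∀ x, (U n).starProjection (ξ x) =
      ∑ i, inner ℝ (b i : V) (ξ x) • (b i : V) := fun x => by
    rw [Submodule.starProjection_apply, ← b.sum_repr' ((U n).orthogonalProjectionOnto (ξ x))]
    simp
  simp only [hb]
  exact Finset.stronglyMeasurable_fun_sum _ fun i _ =>
    (h _).stronglyMeasurable.smul_const _

open ProbabilityTheory

variable {X : Type*} [MeasurableSpace X] (μ : Measure X) [IsProbabilityMeasure μ]
  {V : Type*} [NormedAddCommGroup V] [InnerProductSpace ℝ V] [CompleteSpace V] {ξ : X → V} {R : ℝ}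

/-- The cross term with `s` vanishes after centring, and the variance is `E‖ξ‖² - ‖m‖² ≤ R²`. This
is the inductive step for additivity of variances. -/
theorem integral_norm_add_sub_sq_le (hξ : StronglyMeasurable ξ) (hR : ∀ x, ‖ξ x‖ ≤ R) (s : V) :
    ∫ x, ‖ξ x - (∫ y, ξ y ∂μ) + s‖ ^ 2 ∂μ ≤ ‖s‖ ^ 2 + R ^ 2 := by
  set m := ∫ y, ξ y ∂μ
  have hi : Integrable ξ μ := Integrable.of_bound hξ.aestronglyMeasurable R
    (Filter.Eventually.of_forall hR)
  have hi2 : Integrable (fun x => ‖ξ x‖ ^ 2) μ := Integrable.of_bound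
    (hξ.norm.pow 2).aestronglyMeasurable (R ^ 2) (Filter.Eventually.of_forall fun x => by
      simpa using pow_le_pow_left₀ (norm_nonneg _) (hR x) 2)
  have h1 : ∀ x, ‖ξ x - m + s‖ ^ 2 = ‖ξ x‖ ^ 2 + (2 * inner ℝ (s - m) (ξ x) + ‖s - m‖ ^ 2) :=
    fun x => by
      rw [show ξ x - m + s = ξ x + (s - m) by abel, norm_add_sq_real, real_inner_comm]; ring
  simp only [h1]
  have i1 : Integrable (fun x => 2 * inner ℝ (s - m) (ξ x)) μ := (hi.const_inner _).const_mul _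
  rw [integral_add hi2 (g := fun x => 2 * inner ℝ (s - m) (ξ x) + ‖s - m‖ ^ 2)
    (i1.add (integrable_const _)),
    integral_add ((hi.const_inner _).const_mul _) (integrable_const _), integral_const_mul,
    integral_inner hi]
  have h2 : ∫ x, ‖ξ x‖ ^ 2 ∂μ ≤ R ^ 2 := by
    refine (integral_mono hi2 (integrable_const (R ^ 2)) fun x =>
      pow_le_pow_left₀ (norm_nonneg _) (hR x) 2).trans_eq (by simp)
  have h3 : ‖s - m‖ ^ 2 = ‖s‖ ^ 2 - 2 * inner ℝ s m + ‖m‖ ^ 2 := norm_sub_sq_real s m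
  have h4 : inner ℝ (s - m) m = inner ℝ s m - ‖m‖ ^ 2 := by
    rw [inner_sub_left, real_inner_self_eq_norm_sq]
  change _ + (2 * inner ℝ (s - m) m + _) ≤ _
  rw [h4, h3]
  simp
  nlinarith [sq_nonneg ‖m‖]

theorem integral_norm_sum_sub_sq_le (hξ : StronglyMeasurable ξ) (hR : ∀ x, ‖ξ x‖ ≤ R) (n : ℕ) :
    ∫ z : Fin n → X, ‖∑ i, (ξ (z i) - ∫ y, ξ y ∂μ)‖ ^ 2 ∂(Measure.pi fun _ => μ) ≤ n * R ^ 2 := by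
  set m := ∫ y, ξ y ∂μ
  have hη : StronglyMeasurable fun x => ξ x - m := hξ.sub stronglyMeasurable_const
  have hηR : ∀ x, ‖ξ x - m‖ ≤ R + ‖m‖ := fun x => (norm_sub_le _ _).trans (by linarith [hR x])
  have hint : ∀ n : ℕ, Integrable (fun z : Fin n → X => ‖∑ i, (ξ (z i) - m)‖ ^ 2)
      (Measure.pi fun _ => μ) := fun n =>
    integrable_comp_sum μ hη n (G := fun v => ‖v‖ ^ 2) (by fun_prop) (c := (n * (R + ‖m‖)) ^ 2)
      fun z => by
        simpa using pow_le_pow_left₀ (norm_nonneg _) (norm_sum_comp_le hηR z) 2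
  induction n with
  | zero => simp
  | succ n ih =>
    rw [integral_pi_fin_succ μ _ (hint (n + 1))]
    simp only [Fin.sum_univ_succ, Fin.cons_zero, Fin.cons_succ]
    refine (integral_mono_of_nonneg (Filter.Eventually.of_forall fun w =>
      integral_nonneg fun x => by positivity) ((hint n).add (integrable_const (R ^ 2)))
      (Filter.Eventually.of_forall fun w => integral_norm_add_sub_sq_le μ hξ hR _)).trans ?_
    simp only [Pi.add_apply]
    rw [integral_add (hint n) (integrable_const _)]
    simp only [integral_const, probReal_univ, one_smul]
    push_cast
    linarith

theorem integral_norm_sum_sub_le (hξ : StronglyMeasurable ξ) (hR : ∀ x, ‖ξ x‖ ≤ R) (hR0 : 0 ≤ R)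
    (n : ℕ) :
    ∫ z : Fin n → X, ‖∑ i, ξ (z i) - (n : ℝ) • ∫ y, ξ y ∂μ‖ ∂(Measure.pi fun _ => μ) ≤
      √n * R := by
  have h := integral_norm_sum_sub_sq_le μ hξ hR n
  simp only [Finset.sum_sub_distrib, Finset.sum_const, Finset.card_univ, Fintype.card_fin,
    ← Nat.cast_smul_eq_nsmul ℝ] at h
  set m := ∫ y, ξ y ∂μ
  have hb : ∀ z : Fin n → X, ‖∑ i, ξ (z i) - (n : ℝ) • m‖ ≤ n * R + ‖(n : ℝ) • m‖ := fun z =>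
    (norm_sub_le _ _).trans (by linarith [norm_sum_comp_le hR z])
  have i1 : Integrable (fun z : Fin n → X => ‖∑ i, ξ (z i) - (n : ℝ) • m‖)
      (Measure.pi fun _ => μ) :=
    integrable_comp_sum μ hξ n (G := fun v => ‖v - (n : ℝ) • m‖) (by fun_prop)
      (fun z => by rw [abs_norm]; exact hb z)
  have i2 : Integrable (fun z : Fin n → X => ‖∑ i, ξ (z i) - (n : ℝ) • m‖ ^ 2)
      (Measure.pi fun _ => μ) :=
    integrable_comp_sum μ hξ n (G := fun v => ‖v - (n : ℝ) • m‖ ^ 2) (by fun_prop)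
      (fun z => by
        rw [abs_of_nonneg (by positivity)]
        exact pow_le_pow_left₀ (norm_nonneg _) (hb z) 2)
  set a := ∫ z : Fin n → X, ‖∑ i, ξ (z i) - (n : ℝ) • m‖ ∂(Measure.pi fun _ => μ)
  -- Nonnegativity of the variance of the norm gives `a² ≤ E‖·‖²`.
  have h2 : 0 ≤ ∫ z : Fin n → X, (‖∑ i, ξ (z i) - (n : ℝ) • m‖ - a) ^ 2
      ∂(Measure.pi fun _ => μ) := integral_nonneg fun z => sq_nonneg _
  have h3 : ∀ z : Fin n → X, (‖∑ i, ξ (z i) - (n : ℝ) • m‖ - a) ^ 2 =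
      ‖∑ i, ξ (z i) - (n : ℝ) • m‖ ^ 2 - 2 * a * ‖∑ i, ξ (z i) - (n : ℝ) • m‖ + a ^ 2 :=
    fun z => by ring
  simp only [h3] at h2
  rw [integral_add (f := fun z : Fin n → X => ‖∑ i, ξ (z i) - (n : ℝ) • m‖ ^ 2 -
      2 * a * ‖∑ i, ξ (z i) - (n : ℝ) • m‖) (i2.sub (i1.const_mul _)) (integrable_const _),
    integral_sub i2 (i1.const_mul _), integral_const_mul] at h2
  change 0 ≤ _ - 2 * a * a + _ at h2
  simp only [integral_const, probReal_univ, one_smul] at h2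
  refine abs_le_of_sq_le_sq' ?_ (by positivity) |>.2
  rw [mul_pow, Real.sq_sqrt (Nat.cast_nonneg n)]
  nlinarith

/-- The exponent of the bounded difference inequality absorbs the expected norm of the sum. -/
theorem exp_neg_sq_le_of_log_two_div {δ : ℝ} (h0 : 0 < δ) (h1 : δ < 1) :
    1 ≤ 2 * √(Real.log (2 / δ)) ∧
      Real.exp (-(2 * √(Real.log (2 / δ)) - 1) ^ 2 / 2) ≤ δ := by
  have h2 := Real.log_two_gt_d9
  have hL : Real.log (2 / δ) = Real.log 2 - Real.log δ := Real.log_div two_ne_zero h0.ne'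
  have h3 : Real.log δ < 0 := Real.log_neg h0 h1
  have hs : √(Real.log (2 / δ)) ^ 2 = Real.log 2 - Real.log δ := by
    rw [Real.sq_sqrt (by linarith), hL]
  have h4 : 1 / 2 ≤ √(Real.log (2 / δ)) := Real.le_sqrt_of_sq_le (by rw [hL]; linarith)
  refine ⟨by linarith, ?_⟩
  rw [← Real.le_log_iff_exp_le h0]
  -- With `s = √(log (2 / δ))` and `log δ = log 2 - s²`, the claim reduces to `(s - 1)² + log 2 -
  -- 1/2 ≥ 0`.
  nlinarith [sq_nonneg (√(Real.log (2 / δ)) - 1)]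

/-- The norm of the centred sum is sub-Gaussian about its mean with proxy `n R²`, and the mean is at
most `√n R`. The threshold therefore exceeds the mean by at least `(2 √(log (2 / δ)) - 1) √n R`, and
the Chernoff bound has exponent `-(2 √(log (2 / δ)) - 1)² / 2`. -/
theorem pi_real_norm_sum_sub_ge_le (hξ : StronglyMeasurable ξ) (hR : ∀ x, ‖ξ x‖ ≤ R) (hR0 : 0 < R)
    {n : ℕ} (hn : 0 < n) {δ : ℝ} (h0 : 0 < δ) (h1 : δ < 1) :
    (Measure.pi fun _ : Fin n => μ).real {z |
      2 * √(Real.log (2 / δ)) * (√n * R) ≤ ‖∑ i, ξ (z i) - (n : ℝ) • ∫ y, ξ y ∂μ‖} ≤ δ := by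
  set m := ∫ y, ξ y ∂μ
  set F : V → ℝ := fun v => ‖v - (n : ℝ) • m‖
  have hF : LipschitzWith 1 F := LipschitzWith.of_dist_le_mul fun v w => by
    simpa [F, dist_eq_norm] using abs_norm_sub_norm_le (v - (n : ℝ) • m) (w - (n : ℝ) • m)
  have hb : ∀ z : Fin n → X, F (∑ i, ξ (z i)) ∈ Set.Icc 0 (|F 0| + n * R) := fun z =>
    ⟨norm_nonneg _, (le_abs_self _).trans (hF.abs_le_of_norm_le (norm_sum_comp_le hR z))⟩
  have hm : AEMeasurable (fun z : Fin n → X => F (∑ i, ξ (z i))) (Measure.pi fun _ => μ) :=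
    (hF.continuous.comp_stronglyMeasurable
      (stronglyMeasurable_sum_comp hξ n)).measurable.aemeasurable
  set a := ∫ z : Fin n → X, F (∑ i, ξ (z i)) ∂(Measure.pi fun _ => μ) with ha
  have hsub : HasSubgaussianMGF (fun z : Fin n → X => F (∑ i, ξ (z i)) - a)
      (Real.toNNReal (n * R ^ 2)) (Measure.pi fun _ => μ) := by
    refine ⟨fun t => integrable_exp_mul_of_mem_Icc (a := 0 - a) (b := |F 0| + n * R - a)
      (hm.sub_const _) (Filter.Eventually.of_forall fun z =>
        ⟨sub_le_sub_right (hb z).1 _, sub_le_sub_right (hb z).2 _⟩), fun t => ?_⟩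
    have h := integral_exp_lipschitz_sum_le μ hξ hR t n hF
    have h4 : ∀ z : Fin n → X, Real.exp (t * (F (∑ i, ξ (z i)) - a)) =
        Real.exp (t * F (∑ i, ξ (z i))) * Real.exp (-(t * a)) := fun z => by
      rw [← Real.exp_add]
      ring_nf
    simp only [mgf, h4]
    rw [integral_mul_const]
    refine (mul_le_mul_of_nonneg_right h (Real.exp_pos _).le).trans_eq ?_
    rw [← Real.exp_add, ← ha]
    congr 1
    rw [Real.coe_toNNReal _ (by positivity)]
    ring
  have ha2 : a ≤ √n * R := integral_norm_sum_sub_le μ hξ hR hR0.le n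
  obtain ⟨h2, h3⟩ := exp_neg_sq_le_of_log_two_div h0 h1
  have hnR : 0 < √n * R := by positivity
  have h5 := hsub.measure_ge_le (ε := (2 * √(Real.log (2 / δ)) - 1) * (√n * R))
    (mul_nonneg (by linarith) hnR.le)
  refine (measureReal_mono fun z hz => ?_).trans (h5.trans (le_trans (le_of_eq ?_) h3))
  · simp only [Set.mem_ofPred_eq] at hz ⊢
    change _ ≤ ‖_ - _‖ - a
    linarith
  · congr 1
    have h6 : (√n * R) ^ 2 = n * R ^ 2 := by rw [mul_pow, Real.sq_sqrt (Nat.cast_nonneg n)]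
    rw [Real.coe_toNNReal _ (by positivity), ← h6, mul_pow]
    field_simp

/-- With probability at least `1 - δ`, the empirical mean of `N` i.i.d. vectors of norm at most `R`
is within `2 R √(log (2 / δ) / N)` of the mean. -/
theorem one_sub_le_real_norm_mean_sub_le (hξ : StronglyMeasurable ξ) (hR : ∀ x, ‖ξ x‖ ≤ R)
    {N : ℕ} (hN : 0 < N) {Ω : Type*} [MeasurableSpace Ω] (Pr : Measure Ω) [IsProbabilityMeasure Pr]
    (Z : Fin N → Ω → X) (hZm : ∀ n, Measurable (Z n)) (hZi : iIndepFun Z Pr)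
    (hZμ : ∀ n, Pr.map (Z n) = μ) {δ : ℝ} (h0 : 0 < δ) (h1 : δ < 1) :
    1 - δ ≤ Pr.real {w | ‖(1 / (N : ℝ)) • ∑ n, ξ (Z n w) - ∫ y, ξ y ∂μ‖ ≤
      2 * R * √(Real.log (2 / δ) / N)} := by
  have hX : Nonempty X := nonempty_of_isProbabilityMeasure μ
  have hR0 : 0 ≤ R := (norm_nonneg _).trans (hR hX.some)
  have hN' : (0 : ℝ) < N := Nat.cast_pos.2 hN
  -- If `R = 0`, then `ξ` vanishes and so does the deviation; the tail bound needs `R > 0`.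
  rcases hR0.eq_or_lt with rfl | hR0
  · have h : ∀ x, ξ x = 0 := fun x => norm_le_zero_iff.1 (hR x)
    simp [h, h0.le]
  set m := ∫ y, ξ y ∂μ
  set A := {w | ‖(1 / (N : ℝ)) • ∑ n, ξ (Z n w) - m‖ ≤ 2 * R * √(Real.log (2 / δ) / N)}
  have hmap : Pr.map (fun w n => Z n w) = Measure.pi fun _ => μ := by
    rw [(iIndepFun_iff_map_fun_eq_pi_map fun n => (hZm n).aemeasurable).1 hZi]
    simp only [hZμ]
  have hA : Pr.real Aᶜ ≤ δ := by
    refine le_trans ?_ (pi_real_norm_sum_sub_ge_le μ hξ hR hR0 hN h0 h1)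
    have hms : MeasurableSet {z : Fin N → X |
        2 * √(Real.log (2 / δ)) * (√N * R) ≤ ‖∑ i, ξ (z i) - (N : ℝ) • m‖} :=
      measurableSet_le measurable_const
        ((stronglyMeasurable_sum_comp hξ N).sub stronglyMeasurable_const).norm.measurable
    rw [← hmap, map_measureReal_apply (measurable_pi_lambda _ hZm) hms]
    refine measureReal_mono fun w hw => ?_
    simp only [A, Set.mem_compl_iff, Set.mem_ofPred_eq, not_le, Set.mem_preimage] at hw ⊢
    have h2 : (N : ℝ) • ((1 / (N : ℝ)) • ∑ n, ξ (Z n w) - m) = ∑ n, ξ (Z n w) - (N : ℝ) • m := by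
      rw [smul_sub, smul_smul, mul_one_div_cancel hN'.ne', one_smul]
    rw [← h2, norm_smul, Real.norm_of_nonneg hN'.le]
    refine le_trans (le_of_eq ?_) (mul_le_mul_of_nonneg_left hw.le hN'.le)
    rw [Real.sqrt_div' _ hN'.le]
    have h3 : √(N : ℝ) * √(N : ℝ) = N := Real.mul_self_sqrt hN'.le
    have h4 : √(N : ℝ) ≠ 0 := by positivity
    field_simp
    rw [sq, h3]
  -- Subadditivity suffices here, so measurability of `A` plays no role.
  have h2 : (1 : ℝ) ≤ Pr.real A + Pr.real Aᶜ := by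
    have := measureReal_union_le (μ := Pr) A Aᶜ
    rwa [Set.union_compl_self, probReal_univ] at this
  linarith

end ConcentrationHilbert

/-! ### Hadamard's lemma. -/

section Hadamard

variable {E G : Type*} [NormedAddCommGroup E] [NormedSpace ℝ E] [NormedAddCommGroup G]
  [NormedSpace ℝ G]

theorem contDiff_integral_unitInterval {f : E × ℝ → G} (hf : ContDiff ℝ ∞ f) :
    ContDiff ℝ ∞ fun x => ∫ t in (0 : ℝ)..1, f (x, t) := by
  let χ : ContDiffBump (0 : ℝ) := ⟨1, 2, one_pos, one_lt_two⟩
  -- The integral is the value at `0` of the convolution of the indicator of `(0, 1]` with `t ↦ χ t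
  -- • f (x, -t)`. The cutoff `χ` is `1` on `[-1, 1]` and only serves to give compact support.
  have h := contDiffOn_convolution_right_with_param_comp (n := ⊤) (μ := volume)
    (ContinuousLinearMap.lsmul ℝ ℝ) (s := (Set.univ : Set E)) (v := fun _ => (0 : ℝ))
    contDiffOn_const (f := Set.indicator (Set.Ioc 0 1) (1 : ℝ → ℝ))
    (g := fun x t => χ t • f (x, -t)) (k := Metric.closedBall 0 2) isOpen_univ
    (isCompact_closedBall _ _) (fun p x _ hx => by
      rw [χ.zero_of_le_dist (not_le.1 hx).le, zero_smul])
    ((locallyIntegrable_const (1 : ℝ)).indicator measurableSet_Ioc)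
    (ContDiff.contDiffOn (by
      have := χ.contDiff (n := (⊤ : ℕ∞))
      change ContDiff ℝ ((⊤ : ℕ∞) : WithTop ℕ∞) fun q : E × ℝ => χ q.2 • f (q.1, -q.2)
      exact (this.comp contDiff_snd).smul
        (hf.comp (contDiff_fst.prodMk contDiff_snd.neg))))
  rw [contDiffOn_univ] at h
  convert h using 2 with x
  rw [intervalIntegral.integral_of_le zero_le_one, ← integral_indicator measurableSet_Ioc]
  refine integral_congr_ae (Filter.Eventually.of_forall fun t => ?_)
  by_cases ht : t ∈ Set.Ioc (0 : ℝ) 1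
  · have : χ (-t) = 1 := χ.one_of_mem_closedBall (by
      simp only [Metric.mem_closedBall, dist_zero_right, norm_neg, Real.norm_eq_abs]
      rw [abs_of_pos ht.1]
      exact ht.2)
    simp [ht, this]
  · simp [ht]

/-- **Hadamard's lemma**. -/
theorem exists_contDiff_eq_add_apply_sub {f : E → ℝ} (hf : ContDiff ℝ ∞ f) (c : E) :
    ∃ L : E → E →L[ℝ] ℝ, ContDiff ℝ ∞ L ∧ L c = fderiv ℝ f c ∧
      ∀ x, f x = f c + L x (x - c) := by
  have h1 : ContDiff ℝ ∞ (fderiv ℝ f) := hf.fderiv_right (by simp)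
  have h2 : ContDiff ℝ ∞ fun q : E × ℝ => fderiv ℝ f (c + q.2 • (q.1 - c)) :=
    h1.comp (contDiff_const.add (contDiff_snd.smul (contDiff_fst.sub contDiff_const)))
  refine ⟨fun x => ∫ t in (0 : ℝ)..1, fderiv ℝ f (c + t • (x - c)),
    contDiff_integral_unitInterval h2, by simp, fun x => ?_⟩
  have h3 : Continuous fun t : ℝ => fderiv ℝ f (c + t • (x - c)) :=
    h2.continuous.comp (by fun_prop : Continuous fun t : ℝ => (x, t))
  have h4 : ∀ t ∈ Set.uIcc (0 : ℝ) 1, HasDerivAt (fun t : ℝ => f (c + t • (x - c)))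
      (fderiv ℝ f (c + t • (x - c)) (x - c)) t := fun t _ => by
    have h5 : HasDerivAt (fun t : ℝ => c + t • (x - c)) (x - c) t := by
      simpa using ((hasDerivAt_id t).smul_const (x - c)).const_add c
    exact ((hf.differentiable (by simp)).differentiableAt.hasFDerivAt).comp_hasDerivAt t h5
  have h6 := intervalIntegral.integral_eq_sub_of_hasDerivAt h4
    ((h3.clm_apply continuous_const).intervalIntegrable 0 1)
  rw [← ContinuousLinearMap.intervalIntegral_apply (h3.intervalIntegrable 0 1)] at h6
  simp only [one_smul, add_sub_cancel, zero_smul, add_zero] at h6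
  linarith

end Hadamard

/-! ### Derivations at a point of a manifold. -/

section PointDerivation

theorem euclidean_eq_sum {d : ℕ} (v : EuclideanSpace ℝ (Fin d)) :
    v = ∑ i, v i • EuclideanSpace.single i (1 : ℝ) := by
  simpa using ((EuclideanSpace.basisFun (Fin d) ℝ).sum_repr v).symm

variable {d : ℕ} {P : Type*} [TopologicalSpace P] [ChartedSpace (EuclideanSpace ℝ (Fin d)) P]

namespace PoissonBracket

theorem covector_eq_sum (z : P) (α : TangentSpace (𝓡 d) z →L[ℝ] ℝ) :
    α = ∑ i, α (stdVec z i) • stdCovec z i := by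
  let α' : EuclideanSpace ℝ (Fin d) →L[ℝ] ℝ := α
  change α' = ∑ i, α' (EuclideanSpace.single i (1 : ℝ)) •
    (EuclideanSpace.proj i : EuclideanSpace ℝ (Fin d) →L[ℝ] ℝ)
  ext v
  conv_lhs => rw [euclidean_eq_sum v]
  simp [mul_comm]

theorem bracket_antisymm (B : PoissonBracket d P) (F G : C^∞⟮𝓡 d, P; 𝓘(ℝ, ℝ), ℝ⟯) : B.bracket F G = -B.bracket G F := by
  have h := B.bracket_self (F + G)
  simp only [map_add, LinearMap.add_apply, B.bracket_self, zero_add, add_zero] at h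
  exact eq_neg_of_add_eq_zero_right h

end PoissonBracket

theorem differential_add {f h : P → ℝ} {z : P} (hf : MDifferentiableAt (𝓡 d) 𝓘(ℝ, ℝ) f z)
    (hh : MDifferentiableAt (𝓡 d) 𝓘(ℝ, ℝ) h z) :
    differential (𝓡 d) (f + h) z = differential (𝓡 d) f z + differential (𝓡 d) h z :=
  (hf.hasMFDerivAt.add hh.hasMFDerivAt).mfderiv

theorem differential_sub {f h : P → ℝ} {z : P} (hf : MDifferentiableAt (𝓡 d) 𝓘(ℝ, ℝ) f z)
    (hh : MDifferentiableAt (𝓡 d) 𝓘(ℝ, ℝ) h z) :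
    differential (𝓡 d) (f - h) z = differential (𝓡 d) f z - differential (𝓡 d) h z :=
  (hf.hasMFDerivAt.sub hh.hasMFDerivAt).mfderiv

theorem differential_const_smul {f : P → ℝ} {z : P} (hf : MDifferentiableAt (𝓡 d) 𝓘(ℝ, ℝ) f z)
    (c : ℝ) : differential (𝓡 d) (c • f) z = c • differential (𝓡 d) f z :=
  (hf.hasMFDerivAt.const_smul c).mfderiv

theorem smooth_mdifferentiableAt (F : C^∞⟮𝓡 d, P; 𝓘(ℝ, ℝ), ℝ⟯) (z : P) :
    MDifferentiableAt (𝓡 d) 𝓘(ℝ, ℝ) F z :=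
  (F.contMDiff z).mdifferentiableAt (by simp)

variable [IsManifold (𝓡 d) ∞ P] {z : P}

theorem differential_comp_extChartAt {f : EuclideanSpace ℝ (Fin d) → ℝ} {x : P}
    (hx : x ∈ (chartAt (EuclideanSpace ℝ (Fin d)) z).source)
    (hf : DifferentiableAt ℝ f (extChartAt (𝓡 d) z x)) :
    differential (𝓡 d) (fun y => f (extChartAt (𝓡 d) z y)) x =
      (fderiv ℝ f (extChartAt (𝓡 d) z x)).comp
        (mfderiv (𝓡 d) 𝓘(ℝ, EuclideanSpace ℝ (Fin d)) (extChartAt (𝓡 d) z) x) :=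
  ((hf.hasFDerivAt.hasMFDerivAt).comp x (mdifferentiableAt_extChartAt hx).hasMFDerivAt).mfderiv

/-- A smooth function agrees near `z` with a smooth function of the coordinates. -/
theorem exists_contDiff_eventuallyEq (F : C^∞⟮𝓡 d, P; 𝓘(ℝ, ℝ), ℝ⟯) (z : P) :
    ∃ f : EuclideanSpace ℝ (Fin d) → ℝ, ContDiff ℝ ∞ f ∧
      ∀ᶠ x in nhds z, F x = f (extChartAt (𝓡 d) z x) := by
  obtain ⟨b⟩ : Nonempty (SmoothBumpFunction (𝓡 d) z) := inferInstance
  refine ⟨fun y => b.toContDiffBump y • F ((extChartAt (𝓡 d) z).symm y), ?_, ?_⟩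
  · rw [← contMDiff_iff_contDiff]
    refine contMDiff_of_tsupport fun y hy => ?_
    have hy' : y ∈ (extChartAt (𝓡 d) z).target := by
      have h := tsupport_smul_subset_left _ _ hy
      rw [b.toContDiffBump.tsupport_eq] at h
      exact b.closedBall_subset ⟨h, by simp⟩
    refine (b.toContDiffBump.contDiff.contMDiff).contMDiffAt.smul ?_
    exact F.contMDiff.contMDiffAt.comp y ((contMDiffOn_extChartAt_symm z).contMDiffAt
      ((isOpen_extChartAt_target z).mem_nhds hy'))
  · filter_upwards [b.eventuallyEq_one, (chartAt (EuclideanSpace ℝ (Fin d)) z).open_source.mem_nhds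
      (mem_chart_source _ z)] with x hx hxs
    rw [b.eqOn_source hxs, Function.comp_apply] at hx
    rw [hx, (extChartAt (𝓡 d) z).left_inv (by rwa [extChartAt_source])]
    simp

variable [T2Space P]

/-- A smooth function of the coordinates, cut off outside of the chart. -/
def bumpPullback (b : SmoothBumpFunction (𝓡 d) z) {f : EuclideanSpace ℝ (Fin d) → ℝ}
    (hf : ContDiff ℝ ∞ f) : C^∞⟮𝓡 d, P; 𝓘(ℝ, ℝ), ℝ⟯ :=
  ⟨fun x => b x • f (extChartAt (𝓡 d) z x),
    b.contMDiff_smul (hf.contMDiff.comp_contMDiffOn contMDiffOn_extChartAt)⟩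

theorem bumpPullback_eventuallyEq (b : SmoothBumpFunction (𝓡 d) z)
    {f : EuclideanSpace ℝ (Fin d) → ℝ} (hf : ContDiff ℝ ∞ f) :
    ∀ᶠ x in nhds z, bumpPullback b hf x = f (extChartAt (𝓡 d) z x) := by
  filter_upwards [b.eventuallyEq_one] with x hx
  change b x • f (extChartAt (𝓡 d) z x) = _
  rw [hx, Pi.one_apply, one_smul]

/-- A derivation at `z` only depends on the differential at `z`. -/
theorem derivation_eq_zero_of_differential_eq_zero
    (D : C^∞⟮𝓡 d, P; 𝓘(ℝ, ℝ), ℝ⟯ →ₗ[ℝ] ℝ) (hD : ∀ F G, D (F * G) = D F * G z + F z * D G)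
    (F : C^∞⟮𝓡 d, P; 𝓘(ℝ, ℝ), ℝ⟯) (hF : differential (𝓡 d) F z = 0) : D F = 0 := by
  have hone : D 1 = 0 := by
    have := hD 1 1
    simp only [mul_one, ContMDiffMap.coe_one, Pi.one_apply, one_mul] at this
    linarith
  -- Locality: a bump `β` with `β z = 1` supported where `G = 0` satisfies `β * G = 0`, and the
  -- Leibniz rule leaves `D G = 0`.
  have hloc : ∀ G : C^∞⟮𝓡 d, P; 𝓘(ℝ, ℝ), ℝ⟯, (∀ᶠ x in nhds z, G x = 0) → D G = 0 := by
    intro G hG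
    obtain ⟨b, hb⟩ : ∃ b : SmoothBumpFunction (𝓡 d) z, Function.support b ⊆ {x | G x = 0} := by
      obtain ⟨b, _, hb⟩ := (SmoothBumpFunction.nhds_basis_support (I := 𝓡 d) hG).mem_iff.1 hG
      exact ⟨b, hb⟩
    let β : C^∞⟮𝓡 d, P; 𝓘(ℝ, ℝ), ℝ⟯ := ⟨b, b.contMDiff⟩
    have hβ : ∀ x, β x = b x := fun _ => rfl
    have h0 : β * G = 0 := by
      ext x
      by_cases hx : b x = 0
      · simp [hβ, hx]
      · simp [show G x = 0 from hb hx]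
    have h1 := hD β G
    rw [h0, map_zero, hG.self_of_nhds, hβ, b.eq_one] at h1
    simpa using h1.symm
  obtain ⟨f, hf, hFf⟩ := exists_contDiff_eventuallyEq F z
  obtain ⟨b⟩ : Nonempty (SmoothBumpFunction (𝓡 d) z) := inferInstance
  set c := extChartAt (𝓡 d) z z with hc
  obtain ⟨L, hL, hLc, hfL⟩ := exists_contDiff_eq_add_apply_sub hf c
  have hLc0 : L c = 0 := by
    rw [hLc]
    have h1 : differential (𝓡 d) F z =
        differential (𝓡 d) (fun y => f (extChartAt (𝓡 d) z y)) z :=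
      Filter.EventuallyEq.mfderiv_eq hFf
    rw [hF, differential_comp_extChartAt (mem_chart_source _ z)
      (hf.differentiable (by simp)).differentiableAt, mfderiv_extChartAt_self] at h1
    exact h1.symm
  have hX : ∀ i : Fin d, ContDiff ℝ ∞ fun y : EuclideanSpace ℝ (Fin d) => y i - c i := fun i =>
    by fun_prop
  have hfi : ∀ i : Fin d, ContDiff ℝ ∞ fun y : EuclideanSpace ℝ (Fin d) =>
      L y (EuclideanSpace.single i (1 : ℝ)) := fun i => hL.clm_apply contDiff_const
  -- Near `z`, Hadamard's lemma writes `F` as a constant plus `∑ᵢ (yᵢ - cᵢ) Lᵢ`. Both factors of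
  -- each product vanish at `z`, the second because `dF(z) = 0`, so the Leibniz rule kills every
  -- product.
  have hdiff : D (F - (f c • (1 : C^∞⟮𝓡 d, P; 𝓘(ℝ, ℝ), ℝ⟯) +
      ∑ i, bumpPullback b (hX i) * bumpPullback b (hfi i))) = 0 := by
    refine hloc _ ?_
    have h2 : ∀ᶠ x in nhds z, ∀ i : Fin d, bumpPullback b (hX i) x * bumpPullback b (hfi i) x =
        (extChartAt (𝓡 d) z x i - c i) *
          L (extChartAt (𝓡 d) z x) (EuclideanSpace.single i (1 : ℝ)) := by
      refine Filter.eventually_all.2 fun i => ?_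
      filter_upwards [bumpPullback_eventuallyEq b (hX i), bumpPullback_eventuallyEq b (hfi i)]
        with x h3 h4
      rw [h3, h4]
    filter_upwards [hFf, h2] with x h3 h4
    have h5 : (∑ i, bumpPullback b (hX i) * bumpPullback b (hfi i)) x =
        ∑ i, bumpPullback b (hX i) x * bumpPullback b (hfi i) x := by
      have := map_sum (ContMDiffMap.evalRingHom (I := 𝓡 d) (I' := 𝓘(ℝ, ℝ)) (R := ℝ) (n := ∞) x)
        (fun i => bumpPullback b (hX i) * bumpPullback b (hfi i)) Finset.univ
      exact this
    simp only [ContMDiffMap.coe_sub, ContMDiffMap.coe_add, ContMDiffMap.coe_smul, Pi.sub_apply,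
      Pi.add_apply, Pi.smul_apply, ContMDiffMap.coe_one, Pi.one_apply, h5, h4, h3,
      smul_eq_mul, mul_one]
    set y := extChartAt (𝓡 d) z x
    have h6 : L y (y - c) = ∑ i, (y i - c i) * L y (EuclideanSpace.single i (1 : ℝ)) := by
      conv_lhs => rw [euclidean_eq_sum (y - c)]
      simp
    rw [hfL y, h6]
    simp
  rw [map_sub, map_add, map_smul, hone, map_sum] at hdiff
  have h7 : ∀ i, D (bumpPullback b (hX i) * bumpPullback b (hfi i)) = 0 := fun i => by
    have h8 : bumpPullback b (hfi i) z = 0 := by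
      rw [(bumpPullback_eventuallyEq b (hfi i)).self_of_nhds, ← hc, hLc0]
      rfl
    have h9 : bumpPullback b (hX i) z = 0 := by
      rw [(bumpPullback_eventuallyEq b (hX i)).self_of_nhds, ← hc, sub_self]
    rw [hD, h8, h9]
    simp
  simpa [h7] using hdiff

end PointDerivation

/-! ### The Poisson tensor and the map `B♯`. -/

section Tensor

variable {d : ℕ} {P : Type*} [TopologicalSpace P] [ChartedSpace (EuclideanSpace ℝ (Fin d)) P]
  [T2Space P] [IsManifold (𝓡 d) ∞ P] (B : PoissonBracket d P)

namespace PoissonBracket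

/-- `F ↦ {F, G}(z)` is a derivation at `z`. This makes the choices in the definition of `tensor`
immaterial. -/
theorem bracket_congr_left {z : P} {F F' : C^∞⟮𝓡 d, P; 𝓘(ℝ, ℝ), ℝ⟯}
    (h : differential (𝓡 d) F z = differential (𝓡 d) F' z) (G : C^∞⟮𝓡 d, P; 𝓘(ℝ, ℝ), ℝ⟯) :
    B.bracket F G z = B.bracket F' G z := by
  let ev : C^∞⟮𝓡 d, P; 𝓘(ℝ, ℝ), ℝ⟯ →ₗ[ℝ] ℝ :=
    { toFun := fun F => F z, map_add' := fun _ _ => rfl, map_smul' := fun _ _ => rfl }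
  have h1 := derivation_eq_zero_of_differential_eq_zero (z := z) (ev ∘ₗ B.bracket.flip G)
    (fun F F' => by
      change B.bracket (F * F') G z = _
      rw [B.leibniz]
      rfl) (F - F')
    ((differential_sub (smooth_mdifferentiableAt F z) (smooth_mdifferentiableAt F' z)).trans
      (sub_eq_zero.2 h))
  rw [map_sub, sub_eq_zero] at h1
  exact h1

theorem bracket_congr_right {z : P} {G G' : C^∞⟮𝓡 d, P; 𝓘(ℝ, ℝ), ℝ⟯}
    (h : differential (𝓡 d) G z = differential (𝓡 d) G' z) (F : C^∞⟮𝓡 d, P; 𝓘(ℝ, ℝ), ℝ⟯) :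
    B.bracket F G z = B.bracket F G' z := by
  rw [B.bracket_antisymm F G, B.bracket_antisymm F G']
  exact congrArg Neg.neg (B.bracket_congr_left h F)

theorem tensor_differential (F G : C^∞⟮𝓡 d, P; 𝓘(ℝ, ℝ), ℝ⟯) (z : P) :
    B.tensor z (differential (𝓡 d) F z) (differential (𝓡 d) G z) = B.bracket F G z := by
  rw [tensor, B.bracket_congr_left (exists_differential_eq z _).choose_spec,
    B.bracket_congr_right (exists_differential_eq z _).choose_spec]

theorem tensor_antisymm (z : P) (α β : TangentSpace (𝓡 d) z →L[ℝ] ℝ) :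
    B.tensor z α β = -B.tensor z β α := by
  rw [tensor, B.bracket_antisymm]
  rfl

theorem tensor_add_left (z : P) (α α' β : TangentSpace (𝓡 d) z →L[ℝ] ℝ) :
    B.tensor z (α + α') β = B.tensor z α β + B.tensor z α' β := by
  obtain ⟨F, rfl⟩ := exists_differential_eq z α
  obtain ⟨F', rfl⟩ := exists_differential_eq z α'
  obtain ⟨G, rfl⟩ := exists_differential_eq z β
  have h : differential (𝓡 d) F z + differential (𝓡 d) F' z =
      differential (𝓡 d) (F + F' : C^∞⟮𝓡 d, P; 𝓘(ℝ, ℝ), ℝ⟯) z :=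
    (differential_add (smooth_mdifferentiableAt F z) (smooth_mdifferentiableAt F' z)).symm
  rw [h]
  simp only [tensor_differential, map_add, LinearMap.add_apply]
  rfl

theorem tensor_smul_left (z : P) (c : ℝ) (α β : TangentSpace (𝓡 d) z →L[ℝ] ℝ) :
    B.tensor z (c • α) β = c * B.tensor z α β := by
  obtain ⟨F, rfl⟩ := exists_differential_eq z α
  obtain ⟨G, rfl⟩ := exists_differential_eq z β
  have h : c • differential (𝓡 d) F z =
      differential (𝓡 d) (c • F : C^∞⟮𝓡 d, P; 𝓘(ℝ, ℝ), ℝ⟯) z :=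
    (differential_const_smul (smooth_mdifferentiableAt F z) c).symm
  rw [h]
  simp only [tensor_differential, map_smul, LinearMap.smul_apply]
  rfl

/-- The Poisson tensor as a bilinear form. -/
def tensorForm (z : P) :
    (TangentSpace (𝓡 d) z →L[ℝ] ℝ) →ₗ[ℝ] (TangentSpace (𝓡 d) z →L[ℝ] ℝ) →ₗ[ℝ] ℝ :=
  LinearMap.mk₂ ℝ (B.tensor z) (B.tensor_add_left z) (B.tensor_smul_left z)
    (fun α β β' => by
      simp only [B.tensor_antisymm z α, B.tensor_add_left]
      ring)
    (fun c α β => by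
      simp only [B.tensor_antisymm z α, B.tensor_smul_left, smul_eq_mul]
      ring)

/-- The defining property of the bundle map `B♯`. -/
theorem apply_sharp (z : P) (α β : TangentSpace (𝓡 d) z →L[ℝ] ℝ) :
    α (B.sharp z β) = B.tensor z α β := by
  have h : B.tensor z α β = B.tensorForm z α β := rfl
  rw [h, covector_eq_sum z α, sharp]
  simp only [map_sum, map_smul, LinearMap.sum_apply, LinearMap.smul_apply, smul_eq_mul]
  rw [← covector_eq_sum z α]
  exact Finset.sum_congr rfl fun i _ => mul_comm _ _

/-- The bundle map `B♯` at `z` as a linear map. -/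
def sharpLinear (z : P) : (TangentSpace (𝓡 d) z →L[ℝ] ℝ) →ₗ[ℝ] TangentSpace (𝓡 d) z :=
  ∑ i, (B.tensorForm z (stdCovec z i)).smulRight (stdVec z i)

theorem sharpLinear_apply (z : P) (β : TangentSpace (𝓡 d) z →L[ℝ] ℝ) :
    B.sharpLinear z β = B.sharp z β := by
  simp only [sharpLinear, LinearMap.sum_apply, LinearMap.smulRight_apply]
  rfl

end PoissonBracket

end Tensor

/-! ### Differentials and their sup norms. -/

section Differential

variable {E : Type*} [NormedAddCommGroup E] [NormedSpace ℝ E] {H : Type*} [TopologicalSpace H]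
  {I : ModelWithCorners ℝ E H} {M : Type*} [TopologicalSpace M] [ChartedSpace H M]

theorem abs_differential_le_supDiff {q : ∀ x : M, TangentSpace I x → ℝ} {f : M → ℝ}
    (hf : supDiff I q f ≠ ⊤) (x : M) (v : TangentSpace I x) (hq : v ≠ 0 → 0 < q x v) :
    |differential I f x v| ≤ (supDiff I q f).toReal * √(q x v) := by
  by_cases hv : v = 0
  · rw [hv, map_zero, abs_zero]
    positivity
  · rw [← div_le_iff₀ (Real.sqrt_pos.2 (hq hv)), ← ENNReal.ofReal_le_iff_le_toReal hf]
    exact le_iSup_of_le x (le_iSup_of_le v (le_iSup_of_le hv le_rfl))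

theorem contMDiff_diffTB [IsManifold I 1 M] {f : M → ℝ} {m n : WithTop ℕ∞}
    (hf : ContMDiff I 𝓘(ℝ, ℝ) n f) (hmn : m + 1 ≤ n) :
    ContMDiff I.tangent 𝓘(ℝ, ℝ) m (diffTB I f) :=
  (contMDiff_snd_tangentBundle_modelSpace ℝ 𝓘(ℝ, ℝ)).comp (hf.contMDiff_tangentMap hmn)

end Differential

/-! ### Continuity and local bounds of the metric. -/

section Metric

variable {d : ℕ} {P : Type*} [TopologicalSpace P] [ChartedSpace (EuclideanSpace ℝ (Fin d)) P]
  [IsManifold (𝓡 d) ∞ P] (g : RMetric (𝓡 d) P)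

/-- The squared norm is a continuous function on the tangent bundle. -/
theorem continuous_sqNorm :
    Continuous fun p : TangentBundle (𝓡 d) P => g.inner p.1 p.2 p.2 := by
  have h1 : ContMDiff (𝓡 d).tangent (𝓡 d) 0
      (fun p : TangentBundle (𝓡 d) P => p.1) := Bundle.contMDiff_proj _
  have h2 : ContMDiff (𝓡 d).tangent (𝓡 d).tangent 0 (fun p : TangentBundle (𝓡 d) P =>
      Bundle.TotalSpace.mk' (EuclideanSpace ℝ (Fin d))
        (E := (TangentSpace (𝓡 d) : P → Type _)) p.1 p.2) := contMDiff_id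
  have h3 : ContMDiff (𝓡 d).tangent ((𝓡 d).prod 𝓘(ℝ, ℝ)) 0
      (fun p : TangentBundle (𝓡 d) P =>
        Bundle.TotalSpace.mk' ℝ (E := Bundle.Trivial P ℝ) p.1 (g.inner p.1 p.2 p.2)) := by
    apply ContMDiff.clm_bundle_apply₂ (F₁ := EuclideanSpace ℝ (Fin d))
      (F₂ := EuclideanSpace ℝ (Fin d))
    · exact (g.contMDiff.of_le (by simp)).comp h1
    · exact h2
    · exact h2
  refine continuous_iff_continuousAt.2 fun p => ?_
  have h4 := h3 p
  rw [Bundle.contMDiffAt_totalSpace] at h4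
  exact h4.2.continuousAt

theorem inner_self_nonneg (z : P) (v : TangentSpace (𝓡 d) z) : 0 ≤ g.inner z v v := by
  by_cases hv : v = 0
  · simp [hv]
  · exact (g.pos z v hv).le

theorem continuousOn_sqNorm_symmL (z : P) :
    ContinuousOn (fun p : P × EuclideanSpace ℝ (Fin d) =>
      g.inner p.1
        ((trivializationAt (EuclideanSpace ℝ (Fin d)) (TangentSpace (𝓡 d)) z).symmL ℝ p.1 p.2)
        ((trivializationAt (EuclideanSpace ℝ (Fin d)) (TangentSpace (𝓡 d)) z).symmL ℝ p.1 p.2))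
      ((chartAt (EuclideanSpace ℝ (Fin d)) z).source ×ˢ Set.univ) := by
  set e := trivializationAt (EuclideanSpace ℝ (Fin d)) (TangentSpace (𝓡 d) : P → Type _) z
  have h1 : ContinuousOn (fun p : P × EuclideanSpace ℝ (Fin d) => e.toOpenPartialHomeomorph.symm p)
      ((chartAt (EuclideanSpace ℝ (Fin d)) z).source ×ˢ Set.univ) := by
    have := e.toOpenPartialHomeomorph.symm.continuousOn
    rw [e.toOpenPartialHomeomorph.symm_source, e.target_eq] at this
    simpa [e] using this
  refine ((continuous_sqNorm g).comp_continuousOn h1).congr fun p hp => ?_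
  have hb : p.1 ∈ e.baseSet := by simpa [e] using hp.1
  have h2 := e.mk_symm hb p.2
  simp only [Function.comp_apply]
  rw [← h2]
  have h3 : ((trivializationAt (EuclideanSpace ℝ (Fin d)) (TangentSpace (𝓡 d)) z).symmL ℝ p.1 p.2 :
      TangentSpace (𝓡 d) p.1) = e.symm p.1 p.2 := e.symmL_apply hb p.2
  rw [h3]

/-- In a chart, the Riemannian norm is locally bounded by the norm of the coordinates. -/
theorem exists_sqNorm_symmL_le (z : P) : ∃ A : ℝ, 0 < A ∧ ∀ᶠ x in nhds z,
    ∀ u : EuclideanSpace ℝ (Fin d), √(g.inner x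
      ((trivializationAt (EuclideanSpace ℝ (Fin d)) (TangentSpace (𝓡 d)) z).symmL ℝ x u)
      ((trivializationAt (EuclideanSpace ℝ (Fin d)) (TangentSpace (𝓡 d)) z).symmL ℝ x u))
        ≤ A * ‖u‖ := by
  set e := trivializationAt (EuclideanSpace ℝ (Fin d)) (TangentSpace (𝓡 d) : P → Type _) z
  have hs : (chartAt (EuclideanSpace ℝ (Fin d)) z).source ×ˢ Set.univ ∈
      nhds (z, (0 : EuclideanSpace ℝ (Fin d))) :=
    ((chartAt _ z).open_source.prod isOpen_univ).mem_nhds ⟨mem_chart_source _ z, trivial⟩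
  have h1 := (continuousOn_sqNorm_symmL g z).continuousAt hs
  have h2 := h1.eventually (eventually_lt_nhds (b := 1) (by
    change g.inner z (e.symmL ℝ z 0) (e.symmL ℝ z 0) < 1
    rw [map_zero, map_zero]
    exact one_pos))
  rw [nhds_prod_eq, Filter.eventually_prod_iff] at h2
  obtain ⟨pa, ha, pb, hb, hab⟩ := h2
  obtain ⟨ε, hε, hball⟩ := Metric.eventually_nhds_iff_ball.1 hb
  refine ⟨2 / ε, by positivity, ?_⟩
  filter_upwards [ha] with x hx u
  by_cases hu : u = 0
  · simp [hu]
  have hun : 0 < ‖u‖ := norm_pos_iff.2 hu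
  -- By continuity the squared norm is below `1` near `z` for coordinates of length less than `ε`.
  -- Rescaling `u` to length `ε / 2` yields the constant `2 / ε`.
  have h3 := hab hx (hball ((ε / (2 * ‖u‖)) • u) (by
    rw [mem_ball_zero_iff, norm_smul, Real.norm_of_nonneg (by positivity)]
    field_simp
    linarith))
  simp only [map_smul, smul_apply, smul_eq_mul] at h3
  rw [← mul_assoc, ← sq] at h3
  refine Real.sqrt_le_iff.2 ⟨by positivity, ?_⟩
  have h4 : (ε / (2 * ‖u‖)) ^ 2 * (2 / ε * ‖u‖) ^ 2 = 1 := by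
    field_simp
  have h5 : 0 < (ε / (2 * ‖u‖)) ^ 2 := by positivity
  exact (lt_of_mul_lt_mul_left (h3.trans_eq h4.symm) h5.le).le

end Metric

/-! ### Mixed derivatives of the kernel. -/

section KernelDerivative

variable {d : ℕ} {P : Type*} [TopologicalSpace P] [ChartedSpace (EuclideanSpace ℝ (Fin d)) P]

/-- The derivative of `K` at `(x, y)` in direction `(u, 0)`. -/
def partialFst (K : P × P → ℝ) (x : P) (u : TangentSpace (𝓡 d) x) (y : P) : ℝ :=
  diffTB (𝓡2 d) K (sliceLift x u y)

theorem hasMFDerivAt_kernel_left {K : P × P → ℝ} (hK : ContMDiff (𝓡2 d) 𝓘(ℝ, ℝ) 3 K) (x y : P) :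
    MDifferentiableAt (𝓡 d) 𝓘(ℝ, ℝ) (fun x => K (x, y)) x ∧
      ∀ u, differential (𝓡 d) (fun x => K (x, y)) x u = partialFst K x u y := by
  have h1 : HasMFDerivAt (𝓡2 d) 𝓘(ℝ, ℝ) K (x, y) (mfderiv (𝓡2 d) 𝓘(ℝ, ℝ) K (x, y)) :=
    ((hK _).mdifferentiableAt (by norm_num)).hasMFDerivAt
  have h2 := (hasMFDerivAt_id (I := 𝓡 d) x).prodMk (hasMFDerivAt_const (I := 𝓡 d) (I' := 𝓡 d) y x)
  have h3 := h1.comp x h2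
  exact ⟨h3.mdifferentiableAt, fun u => congrArg (fun L => L u) h3.mfderiv⟩

theorem partialFst_smul (K : P × P → ℝ) (x : P) (a : ℝ) (u : TangentSpace (𝓡 d) x) :
    partialFst K x (a • u) = a • partialFst K x u := by
  funext y
  let u' : EuclideanSpace ℝ (Fin d) := u
  let L : EuclideanSpace ℝ (Fin d) × EuclideanSpace ℝ (Fin d) →L[ℝ] ℝ :=
    differential (𝓡2 d) K (x, y)
  change L (a • u', 0) = a • L (u', 0)
  rw [← map_smul, Prod.smul_mk, smul_zero]

variable [IsManifold (𝓡 d) ∞ P]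

theorem contMDiff_sliceLift (x : P) (u : TangentSpace (𝓡 d) x) :
    ContMDiff (𝓡 d) (𝓡2 d).tangent 1 (sliceLift x u) := by
  have h0 : ContMDiff (𝓡 d) (𝓡 d).tangent 1
      (Bundle.zeroSection (EuclideanSpace ℝ (Fin d)) (TangentSpace (𝓡 d) : P → Type _)) :=
    Bundle.contMDiff_zeroSection ℝ _
  exact (contMDiff_equivTangentBundleProd_symm (I := 𝓡 d) (M := P) (I' := 𝓡 d) (M' := P)).comp
    ((contMDiff_const (c := (⟨x, u⟩ : TangentBundle (𝓡 d) P))).prodMk h0)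

theorem contMDiff_partialFst {K : P × P → ℝ} (hK : ContMDiff (𝓡2 d) 𝓘(ℝ, ℝ) 3 K) (x : P)
    (u : TangentSpace (𝓡 d) x) : ContMDiff (𝓡 d) 𝓘(ℝ, ℝ) 1 (partialFst K x u) :=
  (contMDiff_diffTB hK (m := 1) (by norm_num)).comp (contMDiff_sliceLift x u)

variable {g : RMetric (𝓡 d) P} {g₁ : RMetric (𝓡2 d).tangent (TangentBundle (𝓡2 d) (P × P))}
  {K : P × P → ℝ}

/-- `‖D²K‖_∞`, with values in `[0, ∞]`. -/
def supSecond (g₁ : RMetric (𝓡2 d).tangent (TangentBundle (𝓡2 d) (P × P))) (K : P × P → ℝ) :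
    ℝ≥0∞ :=
  supDiff (𝓡2 d).tangent (fun y v => g₁.inner y v v) (diffTB (𝓡2 d) K)

theorem supSecond_ne_top {g₂ : RMetric (𝓡2 d).tangent.tangent
      (TangentBundle (𝓡2 d).tangent (TangentBundle (𝓡2 d) (P × P)))} (h : MemCb3 g g₁ g₂ K) :
    supSecond g₁ K ≠ ⊤ ∧ 2 * (supSecond g₁ K).toReal ≤ kappa g g₁ K ^ 2 := by
  have h2 : cbNorm2 (𝓡2 d) (prodSq g) (fun y v => g₁.inner y v v) K ≠ ⊤ :=
    (ENNReal.add_ne_top.1 h.2).1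
  refine ⟨(ENNReal.add_ne_top.1 h2).2, ?_⟩
  rw [kappa, Real.sq_sqrt (by positivity)]
  exact mul_le_mul_of_nonneg_left (ENNReal.toReal_mono h2 le_add_self) two_pos.le

/-- `partialFst K x u` is `DK` along the slice lift, so its differential is `D²K` evaluated on the
lifted vector. For unit `u` adaptedness bounds the length of that vector by `|v|`; linearity in `u`
gives the general case. -/
theorem abs_differential_partialFst_le (hg₁ : IsAdapted g g₁) (hK : ContMDiff (𝓡2 d) 𝓘(ℝ, ℝ) 3 K)
    (hS : supSecond g₁ K ≠ ⊤) (x : P)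
    (u : TangentSpace (𝓡 d) x) (y : P) (v : TangentSpace (𝓡 d) y) :
    |differential (𝓡 d) (partialFst K x u) y v| ≤
      (supSecond g₁ K).toReal * √(g.inner x u u) * √(g.inner y v v) := by
  have hunit : ∀ w : TangentSpace (𝓡 d) x, g.inner x w w = 1 →
      |differential (𝓡 d) (partialFst K x w) y v| ≤ (supSecond g₁ K).toReal * √(g.inner y v v) := by
    intro w hw
    have h1 : HasMFDerivAt (𝓡2 d).tangent 𝓘(ℝ, ℝ) (diffTB (𝓡2 d) K) (sliceLift x w y)
        (differential (𝓡2 d).tangent (diffTB (𝓡2 d) K) (sliceLift x w y)) :=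
      ((contMDiff_diffTB hK (m := 1) (by norm_num) _).mdifferentiableAt
        (by norm_num)).hasMFDerivAt
    have h2 := ((contMDiff_sliceLift x w y).mdifferentiableAt (by norm_num)).hasMFDerivAt
    have h3 : differential (𝓡 d) (partialFst K x w) y v =
        differential (𝓡2 d).tangent (diffTB (𝓡2 d) K) (sliceLift x w y)
          (mfderiv (𝓡 d) (𝓡2 d).tangent (sliceLift x w) y v) :=
      congrArg (fun L => L v) (h1.comp y h2).mfderiv
    rw [h3]
    exact (abs_differential_le_supDiff hS _ _ (g₁.pos _ _)).trans
      (mul_le_mul_of_nonneg_left (Real.sqrt_le_sqrt (hg₁ x w y v hw)) ENNReal.toReal_nonneg)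
  set a := √(g.inner x u u) with ha
  have hsq : a ^ 2 = g.inner x u u := Real.sq_sqrt (inner_self_nonneg g x u)
  by_cases hu : u = 0
  · have h0 : partialFst K x u = (0 : ℝ) • partialFst K x u := by
      rw [← partialFst_smul, hu, smul_zero]
    rw [h0, differential_const_smul ((contMDiff_partialFst hK x u y).mdifferentiableAt
      (by norm_num)), zero_smul, zero_apply, abs_zero]
    positivity
  have ha0 : 0 < a := Real.sqrt_pos.2 (g.pos x u hu)
  have h1 : partialFst K x u = a • partialFst K x (a⁻¹ • u) := by
    rw [← partialFst_smul, smul_smul, mul_inv_cancel₀ ha0.ne', one_smul]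
  have h2 : g.inner x (a⁻¹ • u) (a⁻¹ • u) = 1 := by
    simp only [map_smul, smul_apply, smul_eq_mul]
    rw [← hsq]
    field_simp
  rw [h1, differential_const_smul ((contMDiff_partialFst hK x _ y).mdifferentiableAt
    (by norm_num)), smul_apply, smul_eq_mul, abs_mul, abs_of_pos ha0]
  refine (mul_le_mul_of_nonneg_left (hunit _ h2) ha0.le).trans_eq (by ring)

end KernelDerivative

/-! ### Curves and velocities in charts. -/

section Curve

variable {d : ℕ} {P : Type*} [TopologicalSpace P] [ChartedSpace (EuclideanSpace ℝ (Fin d)) P]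

/-- The curve `c` has velocity `w` at time `s`. -/
def HasVelocityAt (c : ℝ → P) (s : ℝ) (w : TangentSpace (𝓡 d) (c s)) : Prop :=
  HasMFDerivAt 𝓘(ℝ, ℝ) (𝓡 d) c s
    (ContinuousLinearMap.toSpanSingleton ℝ (w : EuclideanSpace ℝ (Fin d)))

theorem HasVelocityAt.hasDerivAt_comp {c : ℝ → P} {s : ℝ} {w : TangentSpace (𝓡 d) (c s)}
    (hc : HasVelocityAt c s w) {f : P → ℝ} (hf : MDifferentiableAt (𝓡 d) 𝓘(ℝ, ℝ) f (c s)) :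
    HasDerivAt (fun s => f (c s)) (differential (𝓡 d) f (c s) w) s := by
  let w' : EuclideanSpace ℝ (Fin d) := w
  let L : EuclideanSpace ℝ (Fin d) →L[ℝ] ℝ := differential (𝓡 d) f (c s)
  have h1 : HasFDerivAt (fun s => f (c s)) (L.comp (ContinuousLinearMap.toSpanSingleton ℝ w')) s :=
    hasMFDerivAt_iff_hasFDerivAt.1 (hf.hasMFDerivAt.comp s hc)
  have h2 : L.comp (ContinuousLinearMap.toSpanSingleton ℝ w') 1 = L w' := by simp
  have h3 := h1.hasDerivAt
  rw [h2] at h3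
  exact h3

/-- The curve that has constant velocity `u` in the chart at `z`. -/
def chartLine (z : P) (u : EuclideanSpace ℝ (Fin d)) (s : ℝ) : P :=
  (extChartAt (𝓡 d) z).symm (extChartAt (𝓡 d) z z + s • u)

theorem chartLine_zero (z : P) (u : EuclideanSpace ℝ (Fin d)) : chartLine z u 0 = z := by
  simp [chartLine]

variable [IsManifold (𝓡 d) ∞ P]

theorem hasMFDerivAt_extChartAt_symm (z : P) {y : EuclideanSpace ℝ (Fin d)}
    (hy : y ∈ (extChartAt (𝓡 d) z).target) :
    HasMFDerivAt 𝓘(ℝ, EuclideanSpace ℝ (Fin d)) (𝓡 d) (extChartAt (𝓡 d) z).symm y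
      ((trivializationAt (EuclideanSpace ℝ (Fin d)) (TangentSpace (𝓡 d)) z).symmL ℝ
        ((extChartAt (𝓡 d) z).symm y)) := by
  have hx : (extChartAt (𝓡 d) z).symm y ∈ (chartAt (EuclideanSpace ℝ (Fin d)) z).source := by
    simpa using (extChartAt (𝓡 d) z).map_target hy
  have h1 : MDifferentiableAt 𝓘(ℝ, EuclideanSpace ℝ (Fin d)) (𝓡 d)
      (extChartAt (𝓡 d) z).symm y :=
    ((contMDiffOn_extChartAt_symm (n := ∞) z).contMDiffAt
      ((isOpen_extChartAt_target z).mem_nhds hy)).mdifferentiableAt (by simp)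
  have h2 := h1.hasMFDerivAt
  have h3 := TangentBundle.symmL_trivializationAt (I := 𝓡 d) hx
  rw [(extChartAt (𝓡 d) z).right_inv hy] at h3
  rw [h3]
  simpa using h2

theorem hasVelocityAt_chartLine (z : P) (u : EuclideanSpace ℝ (Fin d)) {s : ℝ}
    (hs : extChartAt (𝓡 d) z z + s • u ∈ (extChartAt (𝓡 d) z).target) :
    HasVelocityAt (chartLine z u) s
      ((trivializationAt (EuclideanSpace ℝ (Fin d)) (TangentSpace (𝓡 d)) z).symmL ℝ
        (chartLine z u s) u) := by
  have h1 : HasFDerivAt (fun s : ℝ => extChartAt (𝓡 d) z z + s • u)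
      (ContinuousLinearMap.toSpanSingleton ℝ u) s := by
    have := ((hasDerivAt_id s).smul_const u).const_add (extChartAt (𝓡 d) z z)
    simpa using this.hasFDerivAt
  let L : EuclideanSpace ℝ (Fin d) →L[ℝ] EuclideanSpace ℝ (Fin d) :=
    (trivializationAt (EuclideanSpace ℝ (Fin d)) (TangentSpace (𝓡 d)) z).symmL ℝ (chartLine z u s)
  have h2 : HasMFDerivAt 𝓘(ℝ, ℝ) (𝓡 d) (chartLine z u) s
      (L.comp (ContinuousLinearMap.toSpanSingleton ℝ u)) :=
    (hasMFDerivAt_extChartAt_symm z hs).comp s h1.hasMFDerivAt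
  have h3 : L.comp (ContinuousLinearMap.toSpanSingleton ℝ u) =
      ContinuousLinearMap.toSpanSingleton ℝ (L u) := by
    ext
    simp
  exact h2.congr_mfderiv h3

end Curve

/-! ### Gradient bound in the reproducing kernel Hilbert space. -/

section KernelBound

section

variable {P : Type*} {K : P × P → ℝ}
  {HK : Type*} [NormedAddCommGroup HK] [InnerProductSpace ℝ HK] [CompleteSpace HK] [RKHS ℝ HK P ℝ]

theorem inner_kerFun_kerFun (hHK : ∀ x y : P, RKHS.kerFun HK x (1 : ℝ) y = K (x, y)) (x y : P) :
    inner ℝ (RKHS.kerFun HK x (1 : ℝ)) (RKHS.kerFun HK y (1 : ℝ)) = K (y, x) := by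
  rw [RKHS.kerFun_inner, hHK]
  simp

theorem inner_kerFun_one (x : P) (h : HK) : inner ℝ (RKHS.kerFun HK x (1 : ℝ)) h = h x := by
  rw [RKHS.kerFun_inner]
  simp

end

variable {d : ℕ} {P : Type*} [TopologicalSpace P] [ChartedSpace (EuclideanSpace ℝ (Fin d)) P]
  [IsManifold (𝓡 d) ∞ P] {g : RMetric (𝓡 d) P} {K : P × P → ℝ}
  {HK : Type*} [NormedAddCommGroup HK] [InnerProductSpace ℝ HK] [CompleteSpace HK] [RKHS ℝ HK P ℝ]

/-- `∂₁∂₂K` is bounded by `S`, in terms of the norms given by `g`. -/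
def MixedDerivativeBound (g : RMetric (𝓡 d) P) (K : P × P → ℝ) (S : ℝ) : Prop :=
  ∀ (x : P) (u : TangentSpace (𝓡 d) x) (y : P) (v : TangentSpace (𝓡 d) y),
    |differential (𝓡 d) (partialFst K x u) y v| ≤ S * √(g.inner x u u) * √(g.inner y v v)

/-- By the reproducing property the squared norm is the second difference of `K` over the pair of
endpoints. Two applications of the mean value inequality, one in each argument, bound it by `S a²
t²`. -/
theorem norm_kerFun_sub_le (hHK : ∀ x y : P, RKHS.kerFun HK x (1 : ℝ) y = K (x, y))
    (hK : ContMDiff (𝓡2 d) 𝓘(ℝ, ℝ) 3 K) {S : ℝ} (hS : 0 ≤ S) (hKS : MixedDerivativeBound g K S)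
    {c : ℝ → P} {w : ∀ s, TangentSpace (𝓡 d) (c s)} {t a : ℝ} (ht : 0 ≤ t) (ha : 0 ≤ a)
    (hc : ∀ s ∈ Set.Icc 0 t, HasVelocityAt c s (w s))
    (hw : ∀ s ∈ Set.Icc 0 t, √(g.inner (c s) (w s) (w s)) ≤ a) :
    ‖RKHS.kerFun HK (c t) (1 : ℝ) - RKHS.kerFun HK (c 0) (1 : ℝ)‖ ≤ √S * a * t := by
  have hsymm : ∀ x y, K (x, y) = K (y, x) := fun x y => by
    rw [← inner_kerFun_kerFun hHK, real_inner_comm, inner_kerFun_kerFun hHK]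
  have h0t : t ∈ Set.Icc 0 t := ⟨ht, le_rfl⟩
  have hpart : ∀ s ∈ Set.Icc 0 t,
      ‖partialFst K (c s) (w s) (c t) - partialFst K (c s) (w s) (c 0)‖ ≤ S * a * a * t := by
    intro s hs
    have h1 : ∀ r ∈ Set.Icc 0 t, HasDerivWithinAt (fun r => partialFst K (c s) (w s) (c r))
        (differential (𝓡 d) (partialFst K (c s) (w s)) (c r) (w r)) (Set.Icc 0 t) r := fun r hr =>
      ((hc r hr).hasDerivAt_comp ((contMDiff_partialFst hK _ _ _).mdifferentiableAt
        (by norm_num))).hasDerivWithinAt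
    have h2 := norm_image_sub_le_of_norm_deriv_le_segment' h1 (C := S * a * a) (fun r hr => by
      refine (hKS _ _ _ _).trans ?_
      have := hw s hs
      have := hw r (Set.Ico_subset_Icc_self hr)
      gcongr) t h0t
    simpa using h2
  have h1 : ∀ s ∈ Set.Icc 0 t, HasDerivWithinAt (fun s => K (c s, c t) - K (c s, c 0))
      (partialFst K (c s) (w s) (c t) - partialFst K (c s) (w s) (c 0)) (Set.Icc 0 t) s := by
    intro s hs
    have h2 := fun y => (hc s hs).hasDerivAt_comp (hasMFDerivAt_kernel_left hK (c s) y).1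
    have h3 := (h2 (c t)).sub (h2 (c 0))
    rw [(hasMFDerivAt_kernel_left hK (c s) _).2, (hasMFDerivAt_kernel_left hK (c s) _).2] at h3
    exact h3.hasDerivWithinAt
  have h2 := norm_image_sub_le_of_norm_deriv_le_segment' h1
    (fun s hs => hpart s (Set.Ico_subset_Icc_self hs)) t h0t
  refine abs_le_of_sq_le_sq' ?_ (by positivity) |>.2
  rw [norm_sub_sq_real, ← real_inner_self_eq_norm_sq, ← real_inner_self_eq_norm_sq,
    inner_kerFun_kerFun hHK, inner_kerFun_kerFun hHK, inner_kerFun_kerFun hHK, mul_pow, mul_pow,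
    Real.sq_sqrt hS]
  rw [hsymm (c t) (c 0), sub_zero] at h2
  have := (le_abs_self _).trans h2
  linarith

/-- The differentials of the functions in the reproducing kernel Hilbert space are bounded. -/
theorem abs_differential_le (hHK : ∀ x y : P, RKHS.kerFun HK x (1 : ℝ) y = K (x, y))
    (hK : ContMDiff (𝓡2 d) 𝓘(ℝ, ℝ) 3 K) {S : ℝ} (hS : 0 ≤ S) (hKS : MixedDerivativeBound g K S)
    {h : HK} {z : P} (hh : MDifferentiableAt (𝓡 d) 𝓘(ℝ, ℝ) h z) (u : TangentSpace (𝓡 d) z) :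
    |differential (𝓡 d) h z u| ≤ √S * ‖h‖ * √(g.inner z u u) := by
  let u' : EuclideanSpace ℝ (Fin d) := u
  set e := trivializationAt (EuclideanSpace ℝ (Fin d)) (TangentSpace (𝓡 d) : P → Type _) z
  have hcont : ContinuousAt (fun s : ℝ => extChartAt (𝓡 d) z z + s • u') 0 := by fun_prop
  have htgt : ∀ᶠ s : ℝ in nhds 0, extChartAt (𝓡 d) z z + s • u' ∈ (extChartAt (𝓡 d) z).target :=
    hcont.eventually_mem ((isOpen_extChartAt_target z).mem_nhds (by simp))
  have hc : ContinuousAt (chartLine z u') 0 := by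
    refine ContinuousAt.comp (g := (extChartAt (𝓡 d) z).symm) ?_ hcont
    exact (continuousOn_extChartAt_symm z).continuousAt
      ((isOpen_extChartAt_target z).mem_nhds (by simp))
  have hself : (e.symmL ℝ z u' : TangentSpace (𝓡 d) z) = u := by
    have h1 := TangentBundle.symmL_trivializationAt (I := 𝓡 d) (mem_chart_source _ z)
    rw [mfderivWithin_range_extChartAt_symm] at h1
    exact congrArg (fun L => L u') h1
  have hd : HasDerivAt (fun s => h (chartLine z u' s)) (differential (𝓡 d) h z u) 0 := by
    have h1 := hasVelocityAt_chartLine z u' htgt.self_of_nhds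
    have h2 : MDifferentiableAt (𝓡 d) 𝓘(ℝ, ℝ) h (chartLine z u' 0) := by
      rwa [chartLine_zero]
    convert h1.hasDerivAt_comp h2 using 1
    rw [chartLine_zero]
    exact congrArg _ hself.symm
  -- The differential is the limit of the right slopes of `h` along the chart line, and each slope
  -- is controlled by `norm_kerFun_sub_le`. The speed of the line is only close to `|u|` for small
  -- times; the slack `η` accounts for this.
  have hslope := (hasDerivWithinAt_iff_tendsto_slope' (s := Set.Ioi 0) (x := 0) (by simp)).1
    hd.hasDerivWithinAt
  refine le_of_forall_pos_le_add fun ε hε => ?_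
  obtain ⟨η, hη, hηε⟩ : ∃ η > 0, √S * ‖h‖ * η ≤ ε := by
    refine ⟨ε / (√S * ‖h‖ + 1), by positivity, ?_⟩
    rw [mul_div_assoc', div_le_iff₀ (by positivity)]
    nlinarith [mul_nonneg (Real.sqrt_nonneg S) (norm_nonneg h)]
  have hsq : ContinuousAt (fun s => √(g.inner (chartLine z u' s) (e.symmL ℝ (chartLine z u' s) u')
      (e.symmL ℝ (chartLine z u' s) u'))) 0 := by
    have hs : (chartAt (EuclideanSpace ℝ (Fin d)) z).source ×ˢ Set.univ ∈
        nhds (chartLine z u' 0, u') :=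
      ((chartAt _ z).open_source.prod isOpen_univ).mem_nhds
        ⟨by rw [chartLine_zero]; exact mem_chart_source _ z, trivial⟩
    have h1 := ((continuousOn_sqNorm_symmL g z).continuousAt hs).comp
      (f := fun s => (chartLine z u' s, u')) (hc.prodMk continuousAt_const)
    exact Real.continuous_sqrt.continuousAt.comp h1
  have hlt : √(g.inner (chartLine z u' 0) (e.symmL ℝ (chartLine z u' 0) u')
      (e.symmL ℝ (chartLine z u' 0) u')) < √(g.inner z u u) + η := by
    rw [chartLine_zero]
    have h1 : g.inner z (e.symmL ℝ z u') (e.symmL ℝ z u') = g.inner z u u :=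
      congrArg (fun v => g.inner z v v) hself
    rw [h1]
    linarith
  obtain ⟨r, hr, hball⟩ := Metric.eventually_nhds_iff_ball.1
    (htgt.and (hsq.eventually (eventually_lt_nhds hlt)))
  have hbd : |differential (𝓡 d) h z u| ≤ √S * ‖h‖ * (√(g.inner z u u) + η) := by
    refine le_of_tendsto hslope.abs ?_
    filter_upwards [Ioo_mem_nhdsGT hr] with t ht
    have h1 : ∀ s ∈ Set.Icc 0 t, s ∈ Metric.ball (0 : ℝ) r := fun s hs => by
      rw [mem_ball_zero_iff, Real.norm_eq_abs, abs_of_nonneg hs.1]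
      exact hs.2.trans_lt ht.2
    have h2 := norm_kerFun_sub_le hHK hK hS hKS ht.1.le (a := √(g.inner z u u) + η) (by positivity)
      (fun s hs => hasVelocityAt_chartLine z u' (hball s (h1 s hs)).1)
      (fun s hs => (hball s (h1 s hs)).2.le)
    rw [slope_def_field, sub_zero, abs_div, abs_of_pos ht.1, div_le_iff₀ ht.1,
      ← inner_kerFun_one, ← inner_kerFun_one, ← inner_sub_left]
    refine (abs_real_inner_le_norm _ _).trans ?_
    refine (mul_le_mul_of_nonneg_right h2 (norm_nonneg h)).trans_eq (by ring)
  linarith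

end KernelBound

/-! ### Differentiability of the functions in the space. -/

section KernelDifferentiable

variable {d : ℕ} {P : Type*} [TopologicalSpace P] [ChartedSpace (EuclideanSpace ℝ (Fin d)) P]
  {K : P × P → ℝ}
  {HK : Type*} [NormedAddCommGroup HK] [InnerProductSpace ℝ HK] [CompleteSpace HK] [RKHS ℝ HK P ℝ]

variable (d HK) in
/-- The continuously differentiable functions in a reproducing kernel Hilbert space. -/
def contMDiffSubmodule : Submodule ℝ HK where
  carrier := {h | ContMDiff (𝓡 d) 𝓘(ℝ, ℝ) 1 h}
  zero_mem' := by
    change ContMDiff (𝓡 d) 𝓘(ℝ, ℝ) 1 (0 : HK)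
    rw [RKHS.coe_zero]
    exact contMDiff_const
  add_mem' := fun {f h} hf hh => by
    change ContMDiff (𝓡 d) 𝓘(ℝ, ℝ) 1 (f + h : HK)
    rw [RKHS.coe_add]
    exact ContMDiff.add hf hh
  smul_mem' := fun c f hf => by
    change ContMDiff (𝓡 d) 𝓘(ℝ, ℝ) 1 (c • f : HK)
    rw [RKHS.coe_smul]
    exact (contDiff_const_smul c).contMDiff.comp hf

theorem span_kerFun_le (hHK : ∀ x y : P, RKHS.kerFun HK x (1 : ℝ) y = K (x, y))
    (hK : ContMDiff (𝓡2 d) 𝓘(ℝ, ℝ) 3 K) :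
    Submodule.span ℝ {k : HK | ∃ (x : P) (v : ℝ), RKHS.kerFun HK x v = k} ≤
      contMDiffSubmodule d HK := by
  refine Submodule.span_le.2 ?_
  rintro _ ⟨x, v, rfl⟩
  have hv : RKHS.kerFun HK x v = v • RKHS.kerFun HK x (1 : ℝ) := by
    rw [← map_smul, smul_eq_mul, mul_one]
  rw [hv]
  refine Submodule.smul_mem _ v ?_
  change ContMDiff (𝓡 d) 𝓘(ℝ, ℝ) 1 (RKHS.kerFun HK x (1 : ℝ))
  rw [show ⇑(RKHS.kerFun HK x (1 : ℝ)) = fun y => K (x, y) from funext (hHK x)]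
  exact (hK.of_le (by norm_num)).comp (contMDiff_const.prodMk contMDiff_id)

theorem exists_seq_contMDiff_tendsto (hHK : ∀ x y : P, RKHS.kerFun HK x (1 : ℝ) y = K (x, y))
    (hK : ContMDiff (𝓡2 d) 𝓘(ℝ, ℝ) 3 K) (h : HK) :
    ∃ f : ℕ → HK, (∀ n, ContMDiff (𝓡 d) 𝓘(ℝ, ℝ) 1 (f n)) ∧
      Filter.Tendsto f Filter.atTop (nhds h) := by
  have hmem : h ∈ (Submodule.span ℝ
      {k : HK | ∃ (x : P) (v : ℝ), RKHS.kerFun HK x v = k}).topologicalClosure := by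
    rw [RKHS.kerFun_dense]
    trivial
  obtain ⟨f, hf, hfh⟩ := mem_closure_iff_seq_limit.1 hmem
  exact ⟨f, fun n => span_kerFun_le hHK hK (hf n), hfh⟩

variable [IsManifold (𝓡 d) ∞ P] {g : RMetric (𝓡 d) P}

/-- The gradient bound for `f m - f n` shows that, in a chart, the derivatives form a uniform Cauchy
sequence on a ball, while values converge by continuity of evaluation. The limit can then be
differentiated term by term. -/
theorem mdifferentiable_of_tendsto (hHK : ∀ x y : P, RKHS.kerFun HK x (1 : ℝ) y = K (x, y))
    (hK : ContMDiff (𝓡2 d) 𝓘(ℝ, ℝ) 3 K) {S : ℝ} (hS : 0 ≤ S) (hKS : MixedDerivativeBound g K S)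
    {f : ℕ → HK} {h : HK} (hf : ∀ n, MDifferentiable (𝓡 d) 𝓘(ℝ, ℝ) (f n))
    (hfh : Filter.Tendsto f Filter.atTop (nhds h)) : MDifferentiable (𝓡 d) 𝓘(ℝ, ℝ) h := by
  intro z
  set φ := extChartAt (𝓡 d) z
  set e := trivializationAt (EuclideanSpace ℝ (Fin d)) (TangentSpace (𝓡 d) : P → Type _) z
  obtain ⟨A, hA, hAe⟩ := exists_sqNorm_symmL_le g z
  have hcont : ContinuousAt φ.symm (φ z) := continuousAt_extChartAt_symm z
  have hAe' : ∀ᶠ y in nhds (φ z), ∀ u : EuclideanSpace ℝ (Fin d),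
      √(g.inner (φ.symm y) (e.symmL ℝ (φ.symm y) u) (e.symmL ℝ (φ.symm y) u)) ≤ A * ‖u‖ :=
    hcont.eventually (by
      rw [(extChartAt (𝓡 d) z).left_inv (mem_extChartAt_source z)]
      exact hAe)
  have htgt : ∀ᶠ y in nhds (φ z), y ∈ φ.target :=
    (isOpen_extChartAt_target z).mem_nhds (mem_extChartAt_target z)
  obtain ⟨r, hr, hball⟩ := Metric.eventually_nhds_iff_ball.1 (htgt.and hAe')
  let D : ℕ → EuclideanSpace ℝ (Fin d) → EuclideanSpace ℝ (Fin d) →L[ℝ] ℝ := fun n y =>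
    (differential (𝓡 d) (f n) (φ.symm y)).comp (e.symmL ℝ (φ.symm y))
  have hD : ∀ n, ∀ y ∈ Metric.ball (φ z) r, HasFDerivAt (fun y => f n (φ.symm y)) (D n y) y :=
    fun n y hy => hasMFDerivAt_iff_hasFDerivAt.1
      (((hf n _).hasMFDerivAt).comp y (hasMFDerivAt_extChartAt_symm z (hball y hy).1))
  have hDsub : ∀ m n, ∀ y ∈ Metric.ball (φ z) r, ‖D m y - D n y‖ ≤ √S * ‖f m - f n‖ * A := by
    intro m n y hy
    refine ContinuousLinearMap.opNorm_le_bound _ (by positivity) fun u => ?_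
    have h1 : MDifferentiableAt (𝓡 d) 𝓘(ℝ, ℝ) (f m - f n : HK) (φ.symm y) := by
      rw [RKHS.coe_sub]
      exact (hf m _).sub (hf n _)
    have h2 := abs_differential_le hHK hK hS hKS h1 (e.symmL ℝ (φ.symm y) u)
    have h3 : differential (𝓡 d) (f m - f n : HK) (φ.symm y) =
        differential (𝓡 d) (f m) (φ.symm y) - differential (𝓡 d) (f n) (φ.symm y) := by
      rw [RKHS.coe_sub]
      exact differential_sub (hf m _) (hf n _)
    rw [h3] at h2
    refine le_trans h2 ?_
    rw [mul_assoc _ A]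
    exact mul_le_mul_of_nonneg_left ((hball y hy).2 u) (by positivity)
  have hUC : UniformCauchySeqOn D Filter.atTop (Metric.ball (φ z) r) := by
    rw [Metric.uniformCauchySeqOn_iff]
    intro ε hε
    obtain ⟨N, hN⟩ := Metric.cauchySeq_iff.1 hfh.cauchySeq (ε / (√S * A + 1)) (by positivity)
    refine ⟨N, fun m hm n hn y hy => ?_⟩
    rw [dist_eq_norm]
    have h1 := hN m hm n hn
    rw [dist_eq_norm, lt_div_iff₀ (by positivity)] at h1
    refine (hDsub m n y hy).trans_lt ?_
    nlinarith [norm_nonneg (f m - f n)]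
  have hlim : ∀ y, ∃ L, y ∈ Metric.ball (φ z) r →
      Filter.Tendsto (fun n => D n y) Filter.atTop (nhds L) := fun y => by
    by_cases hy : y ∈ Metric.ball (φ z) r
    · obtain ⟨L, hL⟩ := cauchySeq_tendsto_of_complete (hUC.cauchySeq hy)
      exact ⟨L, fun _ => hL⟩
    · exact ⟨0, fun h => absurd h hy⟩
  choose D' hD' using hlim
  have hder : HasFDerivAt (fun y => h (φ.symm y)) (D' (φ z)) (φ z) :=
    hasFDerivAt_of_tendstoUniformlyOn Metric.isOpen_ball
      (hUC.tendstoUniformlyOn_of_tendsto hD') hD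
      (fun y _ => ((RKHS.continuous_eval (φ.symm y)).tendsto h).comp hfh)
      (Metric.mem_ball_self hr)
  have h1 : MDifferentiableAt (𝓡 d) 𝓘(ℝ, ℝ) ((fun y => h (φ.symm y)) ∘ φ) z :=
    hder.hasMFDerivAt.mdifferentiableAt.comp z
      (mdifferentiableAt_extChartAt (mem_chart_source _ z))
  refine h1.congr_of_eventuallyEq ?_
  filter_upwards [extChartAt_source_mem_nhds (I := 𝓡 d) z] with x hx
  simp only [Function.comp_apply]
  rw [(extChartAt (𝓡 d) z).left_inv hx]

theorem mdifferentiable_rkhs (hHK : ∀ x y : P, RKHS.kerFun HK x (1 : ℝ) y = K (x, y))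
    (hK : ContMDiff (𝓡2 d) 𝓘(ℝ, ℝ) 3 K) {S : ℝ} (hS : 0 ≤ S) (hKS : MixedDerivativeBound g K S)
    (h : HK) : MDifferentiable (𝓡 d) 𝓘(ℝ, ℝ) h := by
  obtain ⟨f, hf, hfh⟩ := exists_seq_contMDiff_tendsto hHK hK h
  exact mdifferentiable_of_tendsto hHK hK hS hKS
    (fun n => (hf n).mdifferentiable (by norm_num)) hfh

end KernelDifferentiable

/-! ### Continuity of Hamiltonian vector fields. -/

section Continuity

variable {d : ℕ} {P : Type*} [TopologicalSpace P] [ChartedSpace (EuclideanSpace ℝ (Fin d)) P]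
  [IsManifold (𝓡 d) ∞ P] [T2Space P]

/-- A vector field is continuous if it maps smooth functions to continuous functions. -/
theorem continuous_section_of_differential (V : ∀ z : P, TangentSpace (𝓡 d) z)
    (hV : ∀ F : C^∞⟮𝓡 d, P; 𝓘(ℝ, ℝ), ℝ⟯, Continuous fun z => differential (𝓡 d) F z (V z)) :
    Continuous fun z => (⟨z, V z⟩ : TangentBundle (𝓡 d) P) := by
  refine continuous_iff_continuousAt.2 fun z₀ => ?_
  refine (FiberBundle.continuousAt_totalSpace (EuclideanSpace ℝ (Fin d)) _).2
    ⟨continuousAt_id, ?_⟩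
  set e := trivializationAt (EuclideanSpace ℝ (Fin d)) (TangentSpace (𝓡 d) : P → Type _) z₀ with he
  change ContinuousAt (fun x => (e ⟨x, V x⟩).2) z₀
  obtain ⟨b⟩ : Nonempty (SmoothBumpFunction (𝓡 d) z₀) := inferInstance
  have hproj : ∀ i : Fin d, ContDiff ℝ ∞ fun y : EuclideanSpace ℝ (Fin d) => y i := fun i =>
    by fun_prop
  have hcoord : ContinuousAt (fun x => (e ⟨x, V x⟩).2.ofLp) z₀ := by
    refine continuousAt_pi.2 fun i => ?_
    -- Testing with cut-off coordinate functions recovers the components of `V`. Agreement with the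
    -- coordinate is needed in a neighbourhood of each nearby `x`, since differentials at `x` are
    -- compared.
    refine (hV (bumpPullback b (hproj i))).continuousAt.congr ?_
    filter_upwards [(bumpPullback_eventuallyEq b (hproj i)).eventually_nhds,
      (chartAt (EuclideanSpace ℝ (Fin d)) z₀).open_source.mem_nhds (mem_chart_source _ z₀)]
      with x hx hxs
    have h1 : differential (𝓡 d) (bumpPullback b (hproj i)) x =
        differential (𝓡 d) (fun y => extChartAt (𝓡 d) z₀ y i) x :=
      Filter.EventuallyEq.mfderiv_eq hx
    have h2 := TangentBundle.continuousLinearMapAt_trivializationAt (I := 𝓡 d) hxs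
    have h3 : e.continuousLinearMapAt ℝ x (V x) = (e ⟨x, V x⟩).2 :=
      e.continuousLinearMapAt_apply_of_mem ℝ (by simpa [e] using hxs) (V x)
    rw [h1, differential_comp_extChartAt (f := fun y => y i) hxs
      ((hproj i).differentiable (by simp)).differentiableAt, ← h3, h2]
    have h4 : fderiv ℝ (fun y : EuclideanSpace ℝ (Fin d) => y i) (extChartAt (𝓡 d) z₀ x) =
        EuclideanSpace.proj i := (EuclideanSpace.proj (𝕜 := ℝ) i).fderiv
    rw [h4]
    rfl
  exact (PiLp.continuous_toLp 2 _).continuousAt.comp hcoord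

namespace PoissonBracket

variable (B : PoissonBracket d P)

/-- Antisymmetry shifts the differentiation to the smooth `F`. Once `X_F` is known to be continuous,
continuity of `dh` is enough for that of `X_h`, and no regularity of the tensor is needed. -/
theorem differential_hamVF (F : C^∞⟮𝓡 d, P; 𝓘(ℝ, ℝ), ℝ⟯) (h : P → ℝ) (z : P) :
    differential (𝓡 d) F z (B.hamVF h z) = -differential (𝓡 d) h z (B.hamVF F z) := by
  rw [hamVF, hamVF, B.apply_sharp, B.apply_sharp, B.tensor_antisymm]

theorem continuous_hamVF_smooth (F : C^∞⟮𝓡 d, P; 𝓘(ℝ, ℝ), ℝ⟯) :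
    Continuous fun z => (⟨z, B.hamVF F z⟩ : TangentBundle (𝓡 d) P) := by
  refine continuous_section_of_differential _ fun G => ?_
  simp only [hamVF, B.apply_sharp, tensor_differential]
  exact (B.bracket G F).contMDiff.continuous

theorem continuous_hamVF {h : P → ℝ} (hh : ContMDiff (𝓡 d) 𝓘(ℝ, ℝ) 1 h) :
    Continuous fun z => (⟨z, B.hamVF h z⟩ : TangentBundle (𝓡 d) P) := by
  refine continuous_section_of_differential _ fun G => ?_
  simp only [B.differential_hamVF]
  exact (((contMDiff_diffTB hh (m := 0) (by simp)).continuous).comp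
    (B.continuous_hamVF_smooth G)).neg

theorem continuous_sqNorm_hamVF (g : RMetric (𝓡 d) P) {h : P → ℝ}
    (hh : ContMDiff (𝓡 d) 𝓘(ℝ, ℝ) 1 h) :
    Continuous fun z => g.inner z (B.hamVF h z) (B.hamVF h z) :=
  (continuous_sqNorm g).comp (B.continuous_hamVF hh)

end PoissonBracket

end Continuity

/-! ### Pointwise bound on Hamiltonian vector fields. -/

section Bound

variable {d : ℕ} {P : Type*} [TopologicalSpace P] [ChartedSpace (EuclideanSpace ℝ (Fin d)) P]
  [IsManifold (𝓡 d) ∞ P] (g : RMetric (𝓡 d) P)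

theorem sq_inner_le (z : P) (v w : TangentSpace (𝓡 d) z) :
    (g.inner z v w) ^ 2 ≤ g.inner z v v * g.inner z w w := by
  let b : LinearMap.BilinForm ℝ (TangentSpace (𝓡 d) z) :=
    LinearMap.mk₂ ℝ (fun v w => g.inner z v w) (fun _ _ _ => by simp) (fun _ _ _ => by simp)
      (fun _ _ _ => by simp) (fun _ _ _ => by simp)
  exact LinearMap.BilinForm.apply_sq_le_of_symm b (inner_self_nonneg g z)
    ⟨fun v w => g.symm z v w⟩ v w

theorem abs_inner_le (z : P) (v w : TangentSpace (𝓡 d) z) :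
    |g.inner z v w| ≤ √(g.inner z v v) * √(g.inner z w w) := by
  rw [← Real.sqrt_mul (inner_self_nonneg g z v)]
  exact Real.abs_le_sqrt (sq_inner_le g z v w)

/-- The musical isomorphism `g♭` is surjective. -/
theorem exists_inner_eq (z : P) (β : TangentSpace (𝓡 d) z →L[ℝ] ℝ) : ∃ w, g.inner z w = β := by
  let E := EuclideanSpace ℝ (Fin d)
  let G : E →L[ℝ] E →L[ℝ] ℝ := g.inner z
  let T : E →ₗ[ℝ] Module.Dual ℝ E := ContinuousLinearMap.coeLM ℝ ∘ₗ G.toLinearMap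
  have hinj : Function.Injective T := by
    rw [← LinearMap.ker_eq_bot, LinearMap.ker_eq_bot']
    intro v hv
    by_contra hne
    have h1 : T v v = 0 := by rw [hv]; rfl
    exact (g.pos z v hne).ne' h1
  have hsurj := (LinearMap.injective_iff_surjective_of_finrank_eq_finrank
    (Subspace.dual_finrank_eq (K := ℝ) (V := E)).symm).1 hinj
  obtain ⟨w, hw⟩ := hsurj (β : E →L[ℝ] ℝ).toLinearMap
  exact ⟨w, ContinuousLinearMap.coe_injective hw⟩

variable {g}

/-- If `|dh(z) u| ≤ m |u|` then `|X_h(z)| ≤ C m`. -/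
theorem PoissonBracket.sqNorm_hamVF_le [T2Space P] {B : PoissonBracket d P} {C : ℝ}
    (hJ : B.CompatibleBound g C) {h : P → ℝ} {z : P} {m : ℝ} (hm : 0 ≤ m)
    (hh : ∀ u, |differential (𝓡 d) h z u| ≤ m * √(g.inner z u u)) :
    g.inner z (B.hamVF h z) (B.hamVF h z) ≤ C ^ 2 * m ^ 2 := by
  obtain ⟨w, hw⟩ := exists_inner_eq g z (differential (𝓡 d) h z)
  obtain ⟨γ, hγ, hγJ⟩ := hJ
  have hX : B.hamVF h z = B.compatible g z w := by
    rw [PoissonBracket.hamVF, PoissonBracket.compatible, hw]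
  have hw0 := inner_self_nonneg g z w
  -- Here `w` is the gradient of `h` at `z`; testing `dh` on `w` itself gives `|w|² ≤ m |w|`.
  have h1 : g.inner z w w ≤ m * √(g.inner z w w) := by
    have := hh w
    rw [← hw] at this
    exact (le_abs_self _).trans this
  have h2 : √(g.inner z w w) ≤ m := by
    by_contra hlt
    have h3 := Real.mul_self_sqrt hw0
    nlinarith [Real.sqrt_nonneg (g.inner z w w)]
  have h4 : g.inner z w w ≤ m ^ 2 := (Real.sqrt_le_left hm).1 h2
  rw [hX]
  calc g.inner z (B.compatible g z w) (B.compatible g z w) ≤ γ z * g.inner z w w := hγJ z w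
    _ ≤ C ^ 2 * m ^ 2 := mul_le_mul (hγ z).2 h4 hw0 (sq_nonneg C)

end Bound

/-! ### Separability of the space. -/

section Separable

variable {P : Type*} [TopologicalSpace P] {K : P × P → ℝ}
  {HK : Type*} [NormedAddCommGroup HK] [InnerProductSpace ℝ HK] [CompleteSpace HK] [RKHS ℝ HK P ℝ]

theorem continuous_kerFun (hHK : ∀ x y : P, RKHS.kerFun HK x (1 : ℝ) y = K (x, y))
    (hK : Continuous K) : Continuous fun x : P => RKHS.kerFun HK x (1 : ℝ) := by
  refine continuous_iff_continuousAt.2 fun x₀ => tendsto_iff_norm_sub_tendsto_zero.2 ?_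
  have h1 : ∀ x, ‖RKHS.kerFun HK x (1 : ℝ) - RKHS.kerFun HK x₀ (1 : ℝ)‖ =
      √(K (x, x) - 2 * K (x₀, x) + K (x₀, x₀)) := fun x => by
    rw [← inner_kerFun_kerFun hHK, ← inner_kerFun_kerFun hHK, ← inner_kerFun_kerFun hHK,
      real_inner_self_eq_norm_sq, real_inner_self_eq_norm_sq, ← norm_sub_sq_real,
      Real.sqrt_sq (norm_nonneg _)]
  simp only [h1]
  have h2 : Continuous fun x => √(K (x, x) - 2 * K (x₀, x) + K (x₀, x₀)) := by fun_prop
  have h3 := h2.tendsto x₀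
  rwa [show K (x₀, x₀) - 2 * K (x₀, x₀) + K (x₀, x₀) = 0 by ring, Real.sqrt_zero] at h3

/-- Multiples of kernel sections form a continuous image of the separable space `P × ℝ`, and their
span is dense. Separability upgrades weak to strong measurability of `z ↦ T z h`. -/
theorem separableSpace_rkhs [SecondCountableTopology P]
    (hHK : ∀ x y : P, RKHS.kerFun HK x (1 : ℝ) y = K (x, y)) (hK : Continuous K) :
    TopologicalSpace.SeparableSpace HK := by
  rw [← TopologicalSpace.isSeparable_univ_iff]
  have h1 : {k : HK | ∃ (x : P) (v : ℝ), RKHS.kerFun HK x v = k} =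
      Set.range fun q : P × ℝ => q.2 • RKHS.kerFun HK q.1 (1 : ℝ) := by
    ext k
    constructor
    · rintro ⟨x, v, rfl⟩
      exact ⟨(x, v), by simp only [← map_smul, smul_eq_mul, mul_one]⟩
    · rintro ⟨q, rfl⟩
      exact ⟨q.1, q.2, by simp only [← map_smul, smul_eq_mul, mul_one]⟩
  have h2 : TopologicalSpace.IsSeparable
      {k : HK | ∃ (x : P) (v : ℝ), RKHS.kerFun HK x v = k} := by
    rw [h1]
    exact TopologicalSpace.isSeparable_range
      (continuous_snd.smul ((continuous_kerFun hHK hK).comp continuous_fst))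
  have h3 := (h2.span (R := ℝ)).closure
  have h4 : closure (Submodule.span ℝ {k : HK | ∃ (x : P) (v : ℝ), RKHS.kerFun HK x v = k} :
      Set HK) = Set.univ := by
    rw [← Submodule.topologicalClosure_coe, RKHS.kerFun_dense, Submodule.top_coe]
  rwa [h4] at h3

end Separable

/-! ### Population and empirical operators. -/

section Operators

variable {d : ℕ} {P : Type*} [TopologicalSpace P] [ChartedSpace (EuclideanSpace ℝ (Fin d)) P]
  [IsManifold (𝓡 d) ∞ P] [T2Space P] {g : RMetric (𝓡 d) P} {B : PoissonBracket d P}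
  {HK : Type*} [NormedAddCommGroup HK] [InnerProductSpace ℝ HK] [RKHS ℝ HK P ℝ]

theorem PoissonBracket.hamVF_add {f h : HK} {z : P} (hf : MDifferentiableAt (𝓡 d) 𝓘(ℝ, ℝ) f z)
    (hh : MDifferentiableAt (𝓡 d) 𝓘(ℝ, ℝ) h z) :
    B.hamVF (f + h : HK) z = B.hamVF f z + B.hamVF h z := by
  simp only [hamVF, ← sharpLinear_apply]
  rw [RKHS.coe_add, differential_add hf hh, map_add]

theorem PoissonBracket.hamVF_smul {f : HK} {z : P} (hf : MDifferentiableAt (𝓡 d) 𝓘(ℝ, ℝ) f z)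
    (c : ℝ) : B.hamVF (c • f : HK) z = c • B.hamVF f z := by
  simp only [hamVF, ← sharpLinear_apply]
  rw [RKHS.coe_smul, differential_const_smul hf, map_smul]

/-- The operator `A_z* A_z` of the evaluation `A_z h = X_h(z)`. -/
theorem exists_pointOperator [CompleteSpace HK]
    (hd : ∀ h : HK, MDifferentiable (𝓡 d) 𝓘(ℝ, ℝ) h) {R : ℝ} (hR : 0 ≤ R)
    (hb : ∀ (h : HK) (z : P), g.inner z (B.hamVF h z) (B.hamVF h z) ≤ R * ‖h‖ ^ 2) (z : P) :
    ∃ T : HK →L[ℝ] HK, (∀ f h : HK, inner ℝ f (T h) = g.inner z (B.hamVF f z) (B.hamVF h z)) ∧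
      ∀ h, ‖T h‖ ≤ R * ‖h‖ := by
  let b : HK →ₗ[ℝ] HK →ₗ[ℝ] ℝ :=
    LinearMap.mk₂ ℝ (fun f h => g.inner z (B.hamVF f z) (B.hamVF h z))
      (fun f f' h => by
        rw [PoissonBracket.hamVF_add (hd f z) (hd f' z), map_add, add_apply])
      (fun c f h => by
        rw [PoissonBracket.hamVF_smul (hd f z), map_smul, smul_apply])
      (fun f h h' => by
        rw [PoissonBracket.hamVF_add (hd h z) (hd h' z), map_add])
      (fun c f h => by
        rw [PoissonBracket.hamVF_smul (hd h z), map_smul])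
  have hbb : ∀ f h, ‖b f h‖ ≤ R * ‖f‖ * ‖h‖ := fun f h => by
    refine (abs_inner_le g z _ _).trans ?_
    refine (mul_le_mul (Real.sqrt_le_sqrt (hb f z)) (Real.sqrt_le_sqrt (hb h z))
      (Real.sqrt_nonneg _) (Real.sqrt_nonneg _)).trans_eq ?_
    rw [Real.sqrt_mul hR, Real.sqrt_mul hR, Real.sqrt_sq (norm_nonneg _),
      Real.sqrt_sq (norm_nonneg _)]
    linear_combination (‖f‖ * ‖h‖) * Real.mul_self_sqrt hR
  let bc : HK →L[ℝ] HK →L[ℝ] ℝ := b.mkContinuous₂ R hbb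
  have hT : ∀ f h : HK, inner ℝ f (InnerProductSpace.continuousLinearMapOfBilin bc h) =
      g.inner z (B.hamVF f z) (B.hamVF h z) := fun f h => by
    rw [real_inner_comm, InnerProductSpace.continuousLinearMapOfBilin_apply]
    exact g.symm z _ _
  refine ⟨InnerProductSpace.continuousLinearMapOfBilin bc, hT, fun h => ?_⟩
  set T := InnerProductSpace.continuousLinearMapOfBilin bc
  -- Pairing `T h` with itself gives `‖T h‖² ≤ R ‖T h‖ ‖h‖`.
  rcases (norm_nonneg (T h)).eq_or_lt with h0 | h0
  · rw [← h0]
    positivity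
  · refine le_of_mul_le_mul_right ?_ h0
    rw [← real_inner_self_eq_norm_mul_norm, hT]
    refine (le_abs_self _).trans ((hbb (T h) h).trans_eq (by ring))

variable {T : P → HK →L[ℝ] HK}

/-- For `C¹` functions the quadratic form of `T z` is continuous in `z`. Approximation makes it
measurable for every element, polarization gives all matrix coefficients, and weak measurability
suffices in a separable space. -/
theorem stronglyMeasurable_pointOperator [CompleteSpace HK] [TopologicalSpace.SeparableSpace HK]
    [MeasurableSpace P] [BorelSpace P]
    (hT : ∀ z, ∀ f h : HK, inner ℝ f (T z h) = g.inner z (B.hamVF f z) (B.hamVF h z))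
    (hdense : ∀ h : HK, ∃ f : ℕ → HK, (∀ n, ContMDiff (𝓡 d) 𝓘(ℝ, ℝ) 1 (f n)) ∧
      Filter.Tendsto f Filter.atTop (nhds h)) (h : HK) :
    StronglyMeasurable fun z => T z h := by
  have hquad : ∀ h : HK, Measurable fun z => inner ℝ h (T z h) := fun h => by
    obtain ⟨f, hf, hfh⟩ := hdense h
    refine measurable_of_tendsto_metrizable (f := fun n z => inner ℝ (f n) (T z (f n)))
      (fun n => ?_) (tendsto_pi_nhds.2 fun z => ?_)
    · simp only [hT]
      exact (B.continuous_sqNorm_hamVF g (hf n)).measurable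
    · exact hfh.inner (((T z).continuous.tendsto h).comp hfh)
  refine stronglyMeasurable_of_forall_inner fun f => ?_
  have h1 : ∀ z, inner ℝ f (T z h) =
      (inner ℝ (f + h) (T z (f + h)) - inner ℝ f (T z f) - inner ℝ h (T z h)) / 2 := fun z => by
    have h2 : inner ℝ h (T z f) = inner ℝ f (T z h) := by
      rw [hT, hT]
      exact g.symm z _ _
    simp only [map_add, inner_add_left, inner_add_right, h2]
    ring
  simp only [h1]
  exact (((hquad _).sub (hquad _)).sub (hquad _)).div_const 2

/-- `Q` is the Bochner integral of `T z`, which commutes with inner products; pairing with `K_y`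
gives the pointwise formula. -/
theorem exists_isPopulationOperator [CompleteSpace HK] [MeasurableSpace P] {K : P × P → ℝ}
    (hHK : ∀ x y : P, RKHS.kerFun HK x (1 : ℝ) y = K (x, y))
    (μ : Measure P) [IsProbabilityMeasure μ]
    (hT : ∀ z, ∀ f h : HK, inner ℝ f (T z h) = g.inner z (B.hamVF f z) (B.hamVF h z))
    {R : ℝ} (hR : ∀ z h, ‖T z h‖ ≤ R * ‖h‖)
    (hm : ∀ h, StronglyMeasurable fun z => T z h) :
    ∃ Q : HK →L[ℝ] HK, IsPopulationOperator g B K μ Q ∧ ∀ h, Q h = ∫ z, T z h ∂μ := by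
  have hint : ∀ h, Integrable (fun z => T z h) μ := fun h =>
    Integrable.of_bound (hm h).aestronglyMeasurable (R * ‖h‖)
      (Filter.Eventually.of_forall fun z => hR z h)
  let Q₀ : HK →ₗ[ℝ] HK :=
    { toFun := fun h => ∫ z, T z h ∂μ
      map_add' := fun f h => by
        simp only [map_add]
        exact integral_add (hint f) (hint h)
      map_smul' := fun c h => by
        simp only [map_smul, RingHom.id_apply]
        exact integral_smul c _ }
  let Q : HK →L[ℝ] HK := Q₀.mkContinuous R fun h => by
    have := norm_integral_le_of_norm_le_const (μ := μ)
      (Filter.Eventually.of_forall fun z => hR z h)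
    rwa [probReal_univ, mul_one] at this
  have hQ : ∀ f h : HK, inner ℝ f (Q h) = ∫ z, g.inner z (B.hamVF f z) (B.hamVF h z) ∂μ :=
    fun f h => by
      simp only [← hT]
      exact (integral_inner (hint h) f).symm
  refine ⟨Q, ⟨fun f h => ?_, hQ, fun h y => ?_⟩, fun h => rfl⟩
  · simp only [← hT]
    exact (hint h).const_inner f
  · rw [← inner_kerFun_one, hQ, show ⇑(RKHS.kerFun HK y (1 : ℝ)) = fun x => K (y, x) from
      funext (hHK y)]

theorem isEmpiricalOperator_mean [CompleteSpace HK] {K : P × P → ℝ}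
    (hHK : ∀ x y : P, RKHS.kerFun HK x (1 : ℝ) y = K (x, y))
    (hT : ∀ z, ∀ f h : HK, inner ℝ f (T z h) = g.inner z (B.hamVF f z) (B.hamVF h z))
    {N : ℕ} (z : Fin N → P) :
    IsEmpiricalOperator g B K z ((1 / (N : ℝ)) • ∑ n, T (z n)) := by
  have h1 : ∀ f h : HK, inner ℝ f (((1 / (N : ℝ)) • ∑ n, T (z n)) h) =
      (1 / (N : ℝ)) * ∑ n, g.inner (z n) (B.hamVF f (z n)) (B.hamVF h (z n)) := fun f h => by
    simp only [← hT, smul_apply, sum_apply,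
      real_inner_smul_right, inner_sum]
  refine ⟨fun f h => ?_, fun h y => ?_⟩
  · rw [h1, Finset.mul_sum]
    refine Finset.sum_congr rfl fun n _ => ?_
    simp only [empA, map_smul, smul_apply, smul_eq_mul]
    rw [← mul_assoc, div_mul_div_comm, one_mul, Real.mul_self_sqrt (Nat.cast_nonneg N)]
  · rw [← inner_kerFun_one, h1, show ⇑(RKHS.kerFun HK y (1 : ℝ)) = fun x => K (y, x) from
      funext (hHK y)]
    exact congrArg _ (Finset.sum_congr rfl fun n _ => g.symm _ _ _)

end Operators

end PoissonRegression

end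

/-! ### The main theorem. -/

open PoissonRegression
theorem lemma4p1 {d : ℕ} {P : Type*} [TopologicalSpace P] [T2Space P] [SecondCountableTopology P]
    [ChartedSpace (EuclideanSpace ℝ (Fin d)) P] [IsManifold (𝓡 d) ∞ P]
    [MeasurableSpace P] [BorelSpace P]
    (B : PoissonBracket d P) (g : RMetric (𝓡 d) P)
    (g₁ : RMetric (𝓡2 d).tangent (TangentBundle (𝓡2 d) (P × P))) (hg₁ : IsAdapted g g₁)
    (g₂ : RMetric (𝓡2 d).tangent.tangent
      (TangentBundle (𝓡2 d).tangent (TangentBundle (𝓡2 d) (P × P))))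
    (C : ℝ) (hC : 0 < C) (hJ : B.CompatibleBound g C)
    (K : P × P → ℝ) (hK : IsMercer K) (hKb : MemCb3 g g₁ g₂ K)
    {HK : Type*} [NormedAddCommGroup HK] [InnerProductSpace ℝ HK] [CompleteSpace HK]
    [RKHS ℝ HK P ℝ] (hHK : ∀ x y : P, RKHS.kerFun HK x (1 : ℝ) y = K (x, y))
    {Ω : Type*} [MeasurableSpace Ω] (Pr : Measure Ω) [IsProbabilityMeasure Pr]
    (μ : Measure P) [IsProbabilityMeasure μ] {N : ℕ} (hN : 0 < N) (Z : Fin N → Ω → P)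
    (hZm : ∀ n, Measurable (Z n)) (hZi : ProbabilityTheory.iIndepFun Z Pr) (hZμ : ∀ n, Pr.map (Z n) = μ) :
    ∃ (Q : HK →L[ℝ] HK) (QN : (Fin N → P) → HK →L[ℝ] HK),
      IsPopulationOperator g B K μ Q ∧ (∀ z, IsEmpiricalOperator g B K z (QN z)) ∧
      ∀ (h : HK) (δ : ℝ), 0 < δ → δ < 1 →
        1 - δ ≤ Pr.real {w | ‖QN (fun n => Z n w) h - Q h‖ ≤
          (√(8 * Real.log (2 / δ) / N) + 1) * √(Real.log (2 / δ) / N) *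
            C ^ 2 * kappa g g₁ K ^ 2 * ‖h‖} := by
  obtain ⟨hS, hSκ⟩ := supSecond_ne_top hKb
  have hK3 := hKb.1
  have hS0 : 0 ≤ (supSecond g₁ K).toReal := ENNReal.toReal_nonneg
  have hKS : MixedDerivativeBound g K (supSecond g₁ K).toReal :=
    abs_differential_partialFst_le hg₁ hK3 hS
  set S := (supSecond g₁ K).toReal
  have hd : ∀ h : HK, MDifferentiable (𝓡 d) 𝓘(ℝ, ℝ) h := mdifferentiable_rkhs hHK hK3 hS0 hKS
  have hb : ∀ (h : HK) (z : P),
      g.inner z (B.hamVF h z) (B.hamVF h z) ≤ C ^ 2 * S * ‖h‖ ^ 2 := fun h z => by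
    refine (PoissonBracket.sqNorm_hamVF_le hJ (by positivity)
      (abs_differential_le hHK hK3 hS0 hKS (hd h z))).trans_eq ?_
    rw [mul_pow, Real.sq_sqrt hS0, mul_assoc]
  choose T hT hTR using exists_pointOperator (g := g) (B := B) hd (by positivity) hb
  have := separableSpace_rkhs hHK hK3.continuous
  have hm := stronglyMeasurable_pointOperator hT (exists_seq_contMDiff_tendsto hHK hK3)
  obtain ⟨Q, hQ, hQT⟩ := exists_isPopulationOperator hHK μ hT hTR hm
  refine ⟨Q, fun z => (1 / (N : ℝ)) • ∑ n, T (z n), hQ, isEmpiricalOperator_mean hHK hT,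
    fun h δ h0 h1 => ?_⟩
  -- Concentration is applied, for fixed `h`, to `ξ z = T z h`, which is bounded by `C ^ 2 * S *
  -- ‖h‖`.
  refine (one_sub_le_real_norm_mean_sub_le μ (hm h) (fun z => hTR z h) hN Pr Z hZm hZi hZμ h0
    h1).trans (measureReal_mono fun w hw => ?_)
  simp only [Set.mem_ofPred_eq, smul_apply, sum_apply,
    hQT] at hw ⊢
  refine hw.trans ?_
  calc 2 * (C ^ 2 * S * ‖h‖) * √(Real.log (2 / δ) / N)
      = 1 * √(Real.log (2 / δ) / N) * C ^ 2 * (2 * S) * ‖h‖ := by ring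
    _ ≤ _ := by
      -- The factor `1` is enlarged to `√(8 log (2 / δ) / N) + 1`, and `2 * S` to `κ²`.
      gcongr
      exact le_add_of_nonneg_left (Real.sqrt_nonneg _)
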